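/- Let $\Omega\subset\mathbb R^d$ be a compact convex set with non-empty interior, let $\|\cdot\|$ be a norm on $\mathbb R^d$ with dual norm $\|\xi\|_*=\sup\{\xi\cdot u:\|u\|\le 1\}$, let $\alpha>0$, and let $\mathcal M(\Omega)=\{\mu\in L^1(\Omega):\mu\ge 0\}$. For $\mu_0,\mu_1\in\mathcal M(\Omega)$ define the $L^1$ generalized unnormalized Wasserstein distance by $$UW_1(\mu_0,\mu_1)=\inf_{v,\mu,f}\ \int_0^1\!\!\int_\Omega \|v(t,x)\|\,\mu(t,x)\,dx\,dt+\frac1\alpha\int_0^1\!\!\int_\Omega|f(t,x)|\,dx\,dt,$$ where the infimum is over density paths $\mu(t,\cdot)\in\mathcal M(\Omega)$, $t\in[0,1]$, that are jointly Borel in $(t,x)$ and continuous in $t$ with respect to the $L^1(\Omega)$ distance, Borel vector fields $v:[0,1]\times\Omega\to\mathbb R^d$ and Borel source functions $f:[0,1]\times\Omega\to\mathbb R$ (with $\mu v$ and $f$ integrable on $[0,1]\times\Omega$) that satisfy $$\partial_t\mu+\nabla\cdot(\mu v)=f\ \text{ on }[0,1]\times\Omega,\qquad \mu(0,\cdot)=\mu_0,\quad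 \mu(1,\cdot)=\mu_1,$$ with zero flux on $[0,1]\times\partial\Omega$, in the weak sense: for every $\psi\in C^\infty(\mathbb R\times\mathbb R^d)$, $$\int_\Omega\psi(1,x)\mu_1(x)\,dx-\int_\Omega\psi(0,x)\mu_0(x)\,dx=\int_0^1\!\!\int_\Omega\bigl(\mu\,\partial_t\psi+\mu v\cdot\nabla_x\psi+f\psi\bigr)\,dx\,dt .$$ Then $UW_1(\mu_0,\mu_1)$ is finite and $$UW_1(\mu_0,\mu_1)=\sup_\Phi\left\{\int_\Omega\Phi(x)\bigl(\mu_1(x)-\mu_0(x)\bigr)\,dx\ :\ \|\nabla\Phi\|_*\le 1\ \text{a.e. on }\Omega,\ \ |\Phi|\le\frac1\alpha\ \text{on }\Omega\right\},$$ where the supremum is over Lipschitz functions $\Phi:\Omega\to\mathbb R$. -/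

import Mathlib

open MeasureTheory Set Filter Topology
open scoped ContDiff ENNReal InnerProductSpace

namespace UnnormalizedOT

/-- The space `ℝᵈ` with its Lebesgue measure. -/
abbrev Rd (d : ℕ) : Type := EuclideanSpace ℝ (Fin d)

/-- `μ` is an unnormalized density on `Ω`: an `L¹(Ω)` function, non-negative almost everywhere. -/
structure IsDensity {d : ℕ} (Ω : Set (Rd d)) (μ : Rd d → ℝ) : Prop where
  integrable : IntegrableOn μ Ω volume
  nonneg : ∀ᵐ x ∂(volume.restrict Ω), 0 ≤ μ x

/-- The dual norm `‖ξ‖_* = sup {⟪ξ, u⟫ : ‖u‖ ≤ 1}` of a norm `N = ‖·‖` on `ℝᵈ`. -/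
noncomputable def dualNorm {d : ℕ} (N : Seminorm ℝ (Rd d)) (ξ : Rd d) : ℝ :=
  sSup {r : ℝ | ∃ u : Rd d, N u ≤ 1 ∧ r = ⟪ξ, u⟫_ℝ}

/-- `ρ` (the density path), `v` (the velocity) and `f` (the source) satisfy the unnormalized
continuity equation `∂ₜρ + ∇ ⬝ (ρ v) = f` on `[0,1] × Ω`, with zero flux through `∂Ω` and with
`ρ(0) = μ₀`, `ρ(1) = μ₁`. The path `t ↦ ρ(t)` is a continuous curve in the space of densities with
the `L¹(Ω)` distance, and `v`, `f` are Borel. The values of `ρ`, `v`, `f` outside `[0,1] × Ω`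
play no role. -/
structure IsAdmissible {d : ℕ} (Ω : Set (Rd d)) (μ₀ μ₁ : Rd d → ℝ)
    (ρ : ℝ → Rd d → ℝ) (v : ℝ → Rd d → Rd d) (f : ℝ → Rd d → ℝ) : Prop where
  measurable_density : Measurable (fun p : ℝ × Rd d => ρ p.1 p.2)
  measurable_velocity : Measurable (fun p : ℝ × Rd d => v p.1 p.2)
  measurable_source : Measurable (fun p : ℝ × Rd d => f p.1 p.2)
  density : ∀ t ∈ Icc (0 : ℝ) 1, IsDensity Ω (ρ t)
  continuous_path : ∀ t ∈ Icc (0 : ℝ) 1,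
    Tendsto (fun s => ∫ x in Ω, |ρ s x - ρ t x|) (𝓝[Icc (0 : ℝ) 1] t) (𝓝 0)
  initial : ρ 0 =ᵐ[volume.restrict Ω] μ₀
  terminal : ρ 1 =ᵐ[volume.restrict Ω] μ₁
  /-- The momentum and the source are integrable (this only excludes triples of infinite cost). -/
  integrable_momentum :
    IntegrableOn (fun p : ℝ × Rd d => ρ p.1 p.2 • v p.1 p.2) (Icc (0 : ℝ) 1 ×ˢ Ω) volume
  integrable_source : IntegrableOn (fun p : ℝ × Rd d => f p.1 p.2) (Icc (0 : ℝ) 1 ×ˢ Ω) volume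
  /-- The continuity equation in the weak sense. The test functions need not vanish on
  `[0,1] × ∂Ω`, which is the zero flux condition `ρ v ⬝ n = 0` there. Here
  `fderiv ℝ ψ (t, x) (1, 0) = ∂ₜψ(t, x)` and `fderiv ℝ ψ (t, x) (0, w) = ∇ₓψ(t, x) ⬝ w`. -/
  continuity_equation : ∀ ψ : ℝ × Rd d → ℝ, ContDiff ℝ ∞ ψ →
    (∫ x in Ω, ψ (1, x) * μ₁ x) - (∫ x in Ω, ψ (0, x) * μ₀ x) =
      ∫ p in Icc (0 : ℝ) 1 ×ˢ Ω,
        (fderiv ℝ ψ p (1, 0) * ρ p.1 p.2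
          + fderiv ℝ ψ p (0, ρ p.1 p.2 • v p.1 p.2)
          + ψ p * f p.1 p.2)

/-- The cost `∫₀¹∫_Ω ‖v‖ ρ dx dt + (1/α) ∫₀¹∫_Ω |f| dx dt`. -/
noncomputable def cost {d : ℕ} (Ω : Set (Rd d)) (N : Seminorm ℝ (Rd d)) (α : ℝ)
    (ρ : ℝ → Rd d → ℝ) (v : ℝ → Rd d → Rd d) (f : ℝ → Rd d → ℝ) : ℝ≥0∞ :=
  (∫⁻ p in Icc (0 : ℝ) 1 ×ˢ Ω, ENNReal.ofReal (N (v p.1 p.2) * ρ p.1 p.2))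
    + ENNReal.ofReal (1 / α) * ∫⁻ p in Icc (0 : ℝ) 1 ×ˢ Ω, ENNReal.ofReal |f p.1 p.2|

/-- The `L¹` generalized unnormalized Wasserstein distance, as an infimum in `[0, ∞]`
(which is `∞` if there is no admissible triple). -/
noncomputable def UW1 {d : ℕ} (Ω : Set (Rd d)) (N : Seminorm ℝ (Rd d)) (α : ℝ)
    (μ₀ μ₁ : Rd d → ℝ) : ℝ≥0∞ :=
  ⨅ (ρ : ℝ → Rd d → ℝ) (v : ℝ → Rd d → Rd d) (f : ℝ → Rd d → ℝ)
    (_ : IsAdmissible Ω μ₀ μ₁ ρ v f), cost Ω N α ρ v f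

/-- The potentials of the dual problem: Lipschitz functions `Φ` on `Ω` with `‖∇Φ‖_* ≤ 1` almost
everywhere and `|Φ| ≤ 1/α`. A Lipschitz function on a convex body is differentiable at almost
every point of it, so that the clause `DifferentiableAt` is no restriction. -/
structure IsPotential {d : ℕ} (Ω : Set (Rd d)) (N : Seminorm ℝ (Rd d)) (α : ℝ)
    (Φ : Rd d → ℝ) : Prop where
  lipschitz : ∃ K, LipschitzOnWith K Φ Ω
  gradient_le : ∀ᵐ x ∂(volume.restrict Ω),
    DifferentiableAt ℝ Φ x ∧ dualNorm N (gradient Φ x) ≤ 1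
  abs_le : ∀ x ∈ Ω, |Φ x| ≤ 1 / α

end UnnormalizedOT

/-! The proof compares the dynamic problem with the stationary one: write `g = μ₁ - μ₀` as `-∇ ⬝ m +
f` with zero flux and minimize `∫ N(m) + (1/α) ∫ |f|`.

Lower bound. A potential is `1`-Lipschitz for `N` on `Ω`; it extends to the whole space and is
mollified without losing its bounds. Used as a time-independent test function, it bounds every
admissible cost from below (`IsPotential.ofReal_integral_le_cost`).

Upper bound, dynamics. A stationary flow is realized by interpolating linearly between the
densities, plus a small bump `δ t (1 - t)` that keeps the density positive, so that `m / ρ` is a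
velocity. The bump costs at most `δ |Ω| / α` of extra source (`IsFlow.exists_admissible`).

Upper bound, duality. The functions in `L²(Ω)` driven at cost below `r` form an open convex set, so
Hahn–Banach gives, for a function outside it, some `φ` dominated by the flow cost
(`exists_dual_function`). Testing `φ` on small balls, either moved from `y` to `x` or created by a
source, and passing to Lebesgue points gives `φ x - φ y ≤ N (x - y)` and `|φ| ≤ 1/α`: `φ` is a
potential almost everywhere (`exists_nLip_of_dual_function`). Approximation in `L¹`, paid for by a
source, covers data outside `L²`. -/

namespace UnnormalizedOT

/-! ### Norms, dual norms and Lipschitz extension -/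

section Norm

variable {d : ℕ}

lemma continuous_seminorm (N : Seminorm ℝ (Rd d)) : Continuous N :=
  N.convexOn.locallyLipschitz.continuous

lemma exists_seminorm_le (N : Seminorm ℝ (Rd d)) : ∃ K : NNReal, ∀ u, N u ≤ K * ‖u‖ := by
  obtain ⟨C, hC, h⟩ := Seminorm.bound_of_continuous_normedSpace N (continuous_seminorm N)
  exact ⟨⟨C, hC.le⟩, h⟩

lemma exists_norm_le_seminorm (N : Seminorm ℝ (Rd d)) (hN : ∀ u, N u = 0 → u = 0) :
    ∃ C : ℝ, ∀ u, ‖u‖ ≤ C * N u := by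
  rcases (Metric.sphere (0 : Rd d) 1).eq_empty_or_nonempty with h | h
  -- An empty unit sphere means that the space is trivial (`d = 0`).
  · refine ⟨0, fun u => ?_⟩
    by_contra! hu
    have hu0 : u ≠ 0 := by rintro rfl; simp at hu
    have : (‖u‖⁻¹ • u) ∈ Metric.sphere (0 : Rd d) 1 := by
      simp [norm_smul, inv_mul_cancel₀ (norm_ne_zero_iff.2 hu0)]
    simp [h] at this
  · obtain ⟨x, hx, hmin⟩ := (isCompact_sphere (0 : Rd d) 1).exists_isMinOn h
      (continuous_seminorm N).continuousOn
    have hx1 : ‖x‖ = 1 := by simpa using hx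
    have hpos : 0 < N x := lt_of_le_of_ne (apply_nonneg N x) fun h0 => by
      have := hN x h0.symm
      simp [this] at hx1
    refine ⟨(N x)⁻¹, fun u => ?_⟩
    rcases eq_or_ne u 0 with rfl | hu
    · simp
    have hu' : 0 < ‖u‖ := norm_pos_iff.2 hu
    have hmem : (‖u‖⁻¹ • u) ∈ Metric.sphere (0 : Rd d) 1 := by
      simp [norm_smul, inv_mul_cancel₀ hu'.ne']
    have h1 : N x ≤ N (‖u‖⁻¹ • u) := hmin hmem
    rw [map_smul_eq_mul, norm_inv, norm_norm] at h1
    rw [inv_mul_eq_div, le_div_iff₀ hpos]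
    calc ‖u‖ * N x ≤ ‖u‖ * (‖u‖⁻¹ * N u) := by gcongr
      _ = N u := by rw [← mul_assoc, mul_inv_cancel₀ hu'.ne', one_mul]

lemma inner_le_of_dualNorm_le_one (N : Seminorm ℝ (Rd d)) (hN : ∀ u, N u = 0 → u = 0)
    {ξ : Rd d} (hξ : dualNorm N ξ ≤ 1) (u : Rd d) : ⟪ξ, u⟫_ℝ ≤ N u := by
  obtain ⟨C, hC⟩ := exists_norm_le_seminorm N hN
  rcases eq_or_ne (N u) 0 with h | h
  · simp [hN u h]
  have hpos : 0 < N u := lt_of_le_of_ne (apply_nonneg N u) h.symm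
  -- Boundedness matters: `sSup` of an unbounded set is `0`, and `hξ` would then carry no
  -- information.
  have hbdd : BddAbove {r : ℝ | ∃ u : Rd d, N u ≤ 1 ∧ r = ⟪ξ, u⟫_ℝ} := by
    refine ⟨‖ξ‖ * |C|, ?_⟩
    rintro _ ⟨w, hw, rfl⟩
    refine (real_inner_le_norm ξ w).trans ?_
    gcongr
    calc ‖w‖ ≤ C * N w := hC w
      _ ≤ |C| * 1 := mul_le_mul (le_abs_self C) hw (apply_nonneg N w) (abs_nonneg C)
      _ = |C| := mul_one _
  have h1 : ⟪ξ, (N u)⁻¹ • u⟫_ℝ ≤ 1 := by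
    refine (le_csSup hbdd ⟨_, ?_, rfl⟩).trans hξ
    rw [map_smul_eq_mul, norm_inv, Real.norm_of_nonneg hpos.le, inv_mul_cancel₀ h]
  rw [inner_smul_right, inv_mul_le_iff₀ hpos, mul_one] at h1
  exact h1

/-- A function is `1`-Lipschitz with respect to the norm `N`. -/
def NLip (N : Seminorm ℝ (Rd d)) (Φ : Rd d → ℝ) : Prop := ∀ x y, Φ x - Φ y ≤ N (x - y)

lemma NLip.exists_lipschitzWith {N : Seminorm ℝ (Rd d)} {Φ : Rd d → ℝ} (h : NLip N Φ) :
    ∃ K, LipschitzWith K Φ := by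
  obtain ⟨K, hK⟩ := exists_seminorm_le N
  refine ⟨K, LipschitzWith.of_dist_le_mul fun x y => ?_⟩
  rw [Real.dist_eq, dist_eq_norm, abs_le']
  refine ⟨(h x y).trans (hK _), ?_⟩
  rw [neg_sub, ← norm_neg, neg_sub]
  exact (h y x).trans (hK _)

lemma NLip.continuous {N : Seminorm ℝ (Rd d)} {Φ : Rd d → ℝ} (h : NLip N Φ) : Continuous Φ :=
  h.exists_lipschitzWith.choose_spec.continuous

lemma NLip.fderiv_le {N : Seminorm ℝ (Rd d)} {Φ : Rd d → ℝ} (h : NLip N Φ) {x : Rd d}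
    (hx : DifferentiableAt ℝ Φ x) (u : Rd d) : fderiv ℝ Φ x u ≤ N u := by
  have h1 : HasDerivAt (fun t : ℝ => Φ (x + t • u)) (fderiv ℝ Φ x u) 0 :=
    hx.hasFDerivAt.hasLineDerivAt u
  have h2 := h1.tendsto_slope.mono_left (nhdsWithin_mono (0 : ℝ) (s := Ioi 0)
    fun t (ht : 0 < t) => ht.ne')
  refine le_of_tendsto h2 ?_
  filter_upwards [self_mem_nhdsWithin] with t ht
  have ht' : (0 : ℝ) < t := ht
  rw [slope_def_field, sub_zero, div_le_iff₀ ht', zero_smul, add_zero]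
  refine (h _ _).trans_eq ?_
  rw [add_sub_cancel_left, map_smul_eq_mul, Real.norm_of_nonneg ht'.le, mul_comm]

/-- Rademacher's theorem gives differentiability almost everywhere, and difference quotients bound
the differential by `N`. -/
lemma NLip.isPotential {N : Seminorm ℝ (Rd d)} {Φ : Rd d → ℝ} (h : NLip N Φ) {α : ℝ}
    (hb : ∀ x, |Φ x| ≤ 1 / α) (Ω : Set (Rd d)) : IsPotential Ω N α Φ where
  lipschitz := by
    obtain ⟨K, hK⟩ := h.exists_lipschitzWith
    exact ⟨K, hK.lipschitzOnWith⟩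
  gradient_le := by
    obtain ⟨K, hK⟩ := h.exists_lipschitzWith
    filter_upwards [ae_restrict_of_ae hK.ae_differentiableAt] with x hx
    refine ⟨hx, csSup_le ⟨0, 0, by simp⟩ ?_⟩
    rintro _ ⟨u, hu, rfl⟩
    rw [inner_gradient_left]
    exact (h.fderiv_le hx u).trans hu
  abs_le := fun x _ => hb x

/-- McShane extension of bounded functions that are `1`-Lipschitz for `N`. -/
lemma exists_nLip_extension (N : Seminorm ℝ (Rd d)) {G : Set (Rd d)} (hG : G.Nonempty)
    {φ : Rd d → ℝ} {c : ℝ} (hφ : ∀ x ∈ G, ∀ y ∈ G, φ x - φ y ≤ N (x - y))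
    (hc : ∀ x ∈ G, |φ x| ≤ c) :
    ∃ Φ : Rd d → ℝ, NLip N Φ ∧ (∀ x, |Φ x| ≤ c) ∧ EqOn Φ φ G := by
  have : Nonempty G := hG.to_subtype
  have hlow : ∀ x, ∀ y : G, -c ≤ φ y + N (x - y) := fun x y => by
    have := (abs_le.1 (hc y y.2)).1
    have := apply_nonneg N (x - y)
    linarith
  have hbdd : ∀ x, BddBelow (range fun y : G => φ y + N (x - y)) := fun x =>
    ⟨-c, by rintro _ ⟨y, rfl⟩; exact hlow x y⟩
  set F : Rd d → ℝ := fun x => ⨅ y : G, (φ y + N (x - y)) with hF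
  have hFlip : NLip N F := fun x y => by
    rw [sub_le_iff_le_add]
    refine (sub_le_iff_le_add'.1 (le_ciInf fun z : G => ?_))
    have h1 : F x ≤ φ z + N (x - z) := ciInf_le (hbdd x) z
    have h2 : N (x - z) ≤ N (x - y) + N (y - z) := by
      simpa using map_add_le_add N (x - y) (y - z)
    linarith
  have hFG : EqOn F φ G := fun x hx => by
    apply le_antisymm
    · simpa using ciInf_le (hbdd x) ⟨x, hx⟩
    · exact le_ciInf fun y => by linarith [hφ x hx y y.2]
  have hc0 : 0 ≤ c := (abs_nonneg _).trans (hc _ hG.some_mem)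
  -- The infimum is already at least `-c`, so only the upper bound requires truncation, which keeps
  -- the Lipschitz bound.
  refine ⟨fun x => min (F x) c, fun x y => ?_, fun x => abs_le.2 ⟨?_, min_le_right _ _⟩,
    fun x hx => ?_⟩
  · have h1 := hFlip x y
    have h2 := apply_nonneg N (x - y)
    simp only
    rcases min_choice (F y) c with h | h <;> rw [h]
    · linarith [min_le_left (F x) c]
    · linarith [min_le_right (F x) c]
  · exact le_min (le_ciInf (hlow x)) (by linarith)
  · simp only [hFG hx]
    exact min_eq_left (abs_le.1 (hc x hx)).2

end Norm

/-! ### Weak duality -/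

section WeakDuality

variable {d : ℕ}

/-- A Lipschitz function is `1`-Lipschitz for `N` along a segment on almost every point of which
its differential is bounded by `N`. -/
lemma sub_le_of_ae_segment {Ω : Set (Rd d)} {Φ : Rd d → ℝ} {K : NNReal}
    (hΦ : LipschitzOnWith K Φ Ω) (N : Seminorm ℝ (Rd d)) {x y : Rd d}
    (hseg : ∀ s ∈ Icc (0 : ℝ) 1, y + s • (x - y) ∈ Ω)
    (hae : ∀ᵐ s : ℝ, s ∈ Icc (0 : ℝ) 1 → DifferentiableAt ℝ Φ (y + s • (x - y)) ∧
      ∀ u, fderiv ℝ Φ (y + s • (x - y)) u ≤ N u) :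
    Φ x - Φ y ≤ N (x - y) := by
  set γ : ℝ → Rd d := fun s => y + s • (x - y) with hγ
  have hγd : ∀ s, HasDerivAt γ (x - y) s := fun s => by
    have := ((hasDerivAt_id s).smul_const (x - y)).const_add y
    rwa [one_smul] at this
  have hγL : LipschitzWith ‖x - y‖₊ γ := LipschitzWith.of_dist_le_mul fun s t => by
    simp only [hγ]
    rw [dist_add_left, dist_eq_norm, ← sub_smul, norm_smul, mul_comm, coe_nnnorm, dist_eq_norm]
  have hL : LipschitzOnWith (K * ‖x - y‖₊) (Φ ∘ γ) (uIcc 0 1) :=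
    hΦ.comp hγL.lipschitzOnWith (by rw [uIcc_of_le zero_le_one]; exact hseg)
  -- Being Lipschitz, `Φ ∘ γ` is absolutely continuous, hence the integral of its almost everywhere
  -- derivative.
  have hint := hL.absolutelyContinuousOnInterval.integral_deriv_eq_sub
  have hbound : ‖∫ s in (0 : ℝ)..1, deriv (Φ ∘ γ) s‖ ≤ N (x - y) * |1 - 0| := by
    refine intervalIntegral.norm_integral_le_of_norm_le_const_ae ?_
    filter_upwards [hae] with s hs hmem
    rw [uIoc_of_le zero_le_one] at hmem
    obtain ⟨hd, hu⟩ := hs ⟨hmem.1.le, hmem.2⟩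
    rw [(hd.hasFDerivAt.comp_hasDerivAt s (hγd s)).deriv, Real.norm_eq_abs, abs_le']
    refine ⟨hu _, ?_⟩
    rw [← map_neg, ← map_neg_eq_map N (x - y)]
    exact hu _
  rw [hint, sub_zero, abs_one, mul_one, Real.norm_eq_abs] at hbound
  simpa [hγ] using (le_abs_self _).trans hbound

/-- The segment from `y` to `x` may lie inside the null set where the gradient bound fails. By
Fubini, almost every translate of it meets that set in a null set of parameters; such translations
`w` are dense, and `w → 0` gives the claim by continuity. -/
lemma IsPotential.sub_le_of_mem_interior {Ω : Set (Rd d)} (hΩ : Convex ℝ Ω)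
    {N : Seminorm ℝ (Rd d)} (hN : ∀ u, N u = 0 → u = 0) {α : ℝ} {Φ : Rd d → ℝ}
    (h : IsPotential Ω N α Φ) {x y : Rd d} (hx : x ∈ interior Ω) (hy : y ∈ interior Ω) :
    Φ x - Φ y ≤ N (x - y) := by
  obtain ⟨K, hK⟩ := h.lipschitz
  have hA : ∀ᵐ z : Rd d, z ∈ interior Ω →
      DifferentiableAt ℝ Φ z ∧ ∀ u, fderiv ℝ Φ z u ≤ N u := by
    rw [← ae_restrict_iff' isOpen_interior.measurableSet]
    filter_upwards [ae_restrict_of_ae_restrict_of_subset interior_subset h.gradient_le] with z hz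
    refine ⟨hz.1, fun u => ?_⟩
    rw [← inner_gradient_left]
    exact inner_le_of_dualNorm_le_one N hN hz.2 u
  obtain ⟨T, hAT, hTm, hT0⟩ := exists_measurable_superset_of_null hA
  have hline : ∀ᵐ w : Rd d, ∀ᵐ s : ℝ, y + s • (x - y) + w ∉ T := by
    have hm : MeasurableSet {p : Rd d × ℝ | y + p.2 • (x - y) + p.1 ∉ T} :=
      (hTm.preimage (by fun_prop : Measurable fun p : Rd d × ℝ => y + p.2 • (x - y) + p.1)).compl
    refine (Measure.ae_ae_comm (p := fun (w : Rd d) (s : ℝ) => y + s • (x - y) + w ∉ T) hm).2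
      (Eventually.of_forall fun s => ?_)
    have := (measurePreserving_add_left (volume : Measure (Rd d))
      (y + s • (x - y))).quasiMeasurePreserving.ae
      (p := fun z => z ∉ T) (measure_eq_zero_iff_ae_notMem.1 hT0)
    exact this
  have hdense := Measure.dense_of_ae hline
  have hne := mem_closure_iff_nhdsWithin_neBot.1 (hdense 0)
  have hxw : Tendsto (fun w : Rd d => x + w) (𝓝 0) (𝓝 x) := 
    Continuous.tendsto' (by fun_prop) _ _ (add_zero _)
  have hyw : Tendsto (fun w : Rd d => y + w) (𝓝 0) (𝓝 y) := 
    Continuous.tendsto' (by fun_prop) _ _ (add_zero _)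
  have hcont : ∀ z ∈ interior Ω, ContinuousAt Φ z := fun z hz =>
    hK.continuousOn.continuousAt (mem_interior_iff_mem_nhds.1 hz)
  have hlim : Tendsto (fun w : Rd d => Φ (x + w) - Φ (y + w)) (𝓝 0) (𝓝 (Φ x - Φ y)) :=
    ((hcont x hx).tendsto.comp hxw).sub ((hcont y hy).tendsto.comp hyw)
  refine le_of_tendsto (x := 𝓝[{w : Rd d | ∀ᵐ s : ℝ, y + s • (x - y) + w ∉ T}] 0)
    (hlim.mono_left nhdsWithin_le_nhds) ?_
  filter_upwards [self_mem_nhdsWithin, nhdsWithin_le_nhds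
    (hxw.eventually (isOpen_interior.mem_nhds hx)), nhdsWithin_le_nhds
    (hyw.eventually (isOpen_interior.mem_nhds hy))] with w hw hxI hyI
  have hseg : ∀ s ∈ Icc (0 : ℝ) 1, (y + w) + s • ((x + w) - (y + w)) ∈ interior Ω :=
    fun s hs => hΩ.interior.add_smul_sub_mem hyI hxI hs
  rw [← add_sub_add_right_eq_sub x y w]
  refine sub_le_of_ae_segment hK N (fun s hs => interior_subset (hseg s hs)) ?_
  filter_upwards [hw] with s hs hs1
  have e : (y + w) + s • ((x + w) - (y + w)) = y + s • (x - y) + w := by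
    rw [add_sub_add_right_eq_sub]; abel
  have := hseg s hs1
  rw [e] at this ⊢
  by_contra hcon
  exact hs (hAT fun h' => hcon (h' this))

lemma IsPotential.sub_le {Ω : Set (Rd d)} (hΩc : IsCompact Ω) (hΩ : Convex ℝ Ω)
    (hΩi : (interior Ω).Nonempty)
    {N : Seminorm ℝ (Rd d)} (hN : ∀ u, N u = 0 → u = 0) {α : ℝ} {Φ : Rd d → ℝ}
    (h : IsPotential Ω N α Φ) {x y : Rd d} (hx : x ∈ Ω) (hy : y ∈ Ω) :
    Φ x - Φ y ≤ N (x - y) := by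
  obtain ⟨K, hK⟩ := h.lipschitz
  have hcl : closure (interior Ω ×ˢ interior Ω) = Ω ×ˢ Ω := by
    rw [closure_prod_eq, hΩ.closure_interior_eq_closure_of_nonempty_interior hΩi,
      hΩc.isClosed.closure_eq]
  refine le_on_closure (f := fun p : Rd d × Rd d => Φ p.1 - Φ p.2)
    (g := fun p : Rd d × Rd d => N (p.1 - p.2)) (s := interior Ω ×ˢ interior Ω)
    (fun p hp => h.sub_le_of_mem_interior hΩ hN hp.1 hp.2) ?_ ?_ (x := (x, y)) ?_
  · rw [hcl]
    exact (hK.continuousOn.comp continuousOn_fst fun p hp => hp.1).sub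
      (hK.continuousOn.comp continuousOn_snd fun p hp => hp.2)
  · exact ((continuous_seminorm N).comp (continuous_fst.sub continuous_snd)).continuousOn
  · rw [hcl]; exact ⟨hx, hy⟩

/-- Convolution with a probability density averages translates of `Φ`, so it preserves both bounds
with the same constants. -/
lemma NLip.exists_smooth_approx {N : Seminorm ℝ (Rd d)} {Φ : Rd d → ℝ} (h : NLip N Φ) {c : ℝ}
    (hc : ∀ x, |Φ x| ≤ c) {ε : ℝ} (hε : 0 < ε) :
    ∃ ψ : Rd d → ℝ, ContDiff ℝ ∞ ψ ∧ NLip N ψ ∧ (∀ x, |ψ x| ≤ c) ∧ ∀ x, |ψ x - Φ x| ≤ ε := by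
  obtain ⟨K, hK⟩ := h.exists_lipschitzWith
  -- At this radius a `K`-Lipschitz function varies by at most `ε`; the `+ 1` allows `K = 0`.
  have hr : 0 < ε / (K + 1) := by positivity
  let b : ContDiffBump (0 : Rd d) := ⟨ε / (K + 1) / 2, ε / (K + 1), by positivity, by linarith⟩
  set k := b.normed volume with hk
  have hcomp : HasCompactSupport k := b.hasCompactSupport_normed
  have hkc : Continuous k := b.continuous_normed
  have hk0 : ∀ z, 0 ≤ k z := b.nonneg_normed
  have hk1 : ∫ z, k z = 1 := b.integral_normed
  have hint : ∀ x, Integrable (fun z => k z * Φ (x - z)) := fun x =>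
    (hkc.mul (h.continuous.comp (by fun_prop))).integrable_of_hasCompactSupport hcomp.mul_right
  have hki : Integrable k := b.integrable_normed
  set ψ : Rd d → ℝ := MeasureTheory.convolution k Φ (ContinuousLinearMap.lsmul ℝ ℝ) volume with hψ
  have hψx : ∀ x, ψ x = ∫ z, k z * Φ (x - z) := fun x => by
    simp [hψ, MeasureTheory.convolution_def]
  refine ⟨ψ, ?_, fun x y => ?_, fun x => ?_, fun x => ?_⟩
  · exact hcomp.contDiff_convolution_left (ContinuousLinearMap.lsmul ℝ ℝ) b.contDiff_normed h.continuous.locallyIntegrable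
  · rw [hψx, hψx, ← integral_sub (hint x) (hint y)]
    calc ∫ z, (k z * Φ (x - z) - k z * Φ (y - z)) ≤ ∫ z, k z * N (x - y) := by
          refine integral_mono ((hint x).sub (hint y)) (hki.mul_const _) fun z => ?_
          simp only [← mul_sub]
          have := h (x - z) (y - z)
          rw [sub_sub_sub_cancel_right] at this
          exact mul_le_mul_of_nonneg_left this (hk0 z)
      _ = N (x - y) := by rw [integral_mul_const, hk1, one_mul]
  · rw [hψx]
    calc |∫ z, k z * Φ (x - z)| ≤ ∫ z, k z * c := by
          refine norm_integral_le_of_norm_le (f := fun z => k z * Φ (x - z)) (hki.mul_const c)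
            (Eventually.of_forall fun z => ?_)
          rw [norm_mul, Real.norm_of_nonneg (hk0 z)]
          exact mul_le_mul_of_nonneg_left (hc _) (hk0 z)
      _ = c := by rw [integral_mul_const, hk1, one_mul]
  · rw [← Real.dist_eq]
    refine ContDiffBump.dist_normed_convolution_le (φ := b) h.continuous.aestronglyMeasurable
      fun y hy => ?_
    have h1 : dist y x < ε / (K + 1) := hy
    calc dist (Φ y) (Φ x) ≤ K * dist y x := hK.dist_le_mul _ _
      _ ≤ (K + 1) * (ε / (K + 1)) := by gcongr; simp
      _ = ε := by field_simp

lemma ae_prod_of_forall_ae {I : Set ℝ} (hI : MeasurableSet I) {Ω : Set (Rd d)}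
    {p : ℝ × Rd d → Prop} (hp : MeasurableSet {z | p z})
    (h : ∀ t ∈ I, ∀ᵐ x ∂(volume.restrict Ω), p (t, x)) :
    ∀ᵐ z ∂(volume.restrict (I ×ˢ Ω)), p z := by
  rw [Measure.volume_eq_prod, ← Measure.prod_restrict, Measure.ae_prod_iff_ae_ae hp]
  filter_upwards [ae_restrict_mem hI] with t ht using h t ht

/-- For a test function independent of time the term in `∂ₜψ` vanishes, and the two remaining terms
are bounded pointwise by the cost integrands. -/
lemma IsAdmissible.ofReal_integral_le_cost_of_smooth {Ω : Set (Rd d)}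
    {μ₀ μ₁ : Rd d → ℝ} (hΩc : IsCompact Ω) (hμ₀ : IsDensity Ω μ₀) (hμ₁ : IsDensity Ω μ₁)
    {ρ : ℝ → Rd d → ℝ} {v : ℝ → Rd d → Rd d} {f : ℝ → Rd d → ℝ}
    (hadm : IsAdmissible Ω μ₀ μ₁ ρ v f) {N : Seminorm ℝ (Rd d)} {α : ℝ} {ψ : Rd d → ℝ}
    (hψ : ContDiff ℝ ∞ ψ) (hN : NLip N ψ) (hb : ∀ x, |ψ x| ≤ 1 / α) :
    ENNReal.ofReal (∫ x in Ω, ψ x * (μ₁ x - μ₀ x)) ≤ cost Ω N α ρ v f := by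
  have hd : Differentiable ℝ ψ := hψ.differentiable (by simp)
  have hi : ∀ {μ}, IsDensity Ω μ → IntegrableOn (fun x => ψ x * μ x) Ω := fun {μ} hμ =>
    hμ.integrable.continuousOn_mul hψ.continuous.continuousOn hΩc
  have hfd : ∀ (p : ℝ × Rd d) (q : ℝ × Rd d),
      fderiv ℝ (fun p : ℝ × Rd d => ψ p.2) p q = fderiv ℝ ψ p.2 q.2 := fun p q => by
    have := (hd p.2).hasFDerivAt.comp p (hasFDerivAt_snd (𝕜 := ℝ) (p := p))
    rw [show (fun p : ℝ × Rd d => ψ p.2) = ψ ∘ Prod.snd from rfl, this.fderiv]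
    rfl
  have hce := hadm.continuity_equation (fun p => ψ p.2) (hψ.comp contDiff_snd)
  simp only [hfd, map_zero, zero_mul, zero_add] at hce
  simp only [mul_sub]
  rw [integral_sub (hi hμ₁) (hi hμ₀), hce]
  have hρ : ∀ᵐ p ∂(volume.restrict (Icc (0 : ℝ) 1 ×ˢ Ω)), 0 ≤ ρ p.1 p.2 :=
    ae_prod_of_forall_ae measurableSet_Icc
      (measurableSet_le measurable_const hadm.measurable_density)
      fun t ht => (hadm.density t ht).nonneg
  have hfm : Measurable fun p : ℝ × Rd d => ENNReal.ofReal |f p.1 p.2| :=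
    (hadm.measurable_source.norm).ennreal_ofReal
  have habs : ∀ x u, |fderiv ℝ ψ x u| ≤ N u := fun x u => by
    rw [abs_le']
    refine ⟨hN.fderiv_le (hd x) u, ?_⟩
    rw [← map_neg, ← map_neg_eq_map N u]
    exact hN.fderiv_le (hd x) _
  rw [cost, ← lintegral_const_mul _ hfm, ← lintegral_add_right _ (hfm.const_mul _)]
  refine (ENNReal.ofReal_le_ofReal (le_abs_self _)).trans ?_
  rw [← Real.norm_eq_abs, ofReal_norm]
  refine (enorm_integral_le_lintegral_enorm _).trans (lintegral_mono_ae ?_)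
  filter_upwards [hρ] with p hp
  have hα : 0 ≤ 1 / α := (abs_nonneg _).trans (hb p.2)
  rw [← ENNReal.ofReal_mul hα, ← ENNReal.ofReal_add (mul_nonneg (apply_nonneg N _) hp)
    (by positivity), ← ofReal_norm]
  refine ENNReal.ofReal_le_ofReal ((norm_add_le _ _).trans (add_le_add ?_ ?_))
  · refine (habs _ _).trans_eq ?_
    rw [map_smul_eq_mul, Real.norm_of_nonneg hp, mul_comm]
  · rw [norm_mul]
    exact mul_le_mul_of_nonneg_right (hb _) (abs_nonneg _)

lemma integral_mul_le_of_abs_sub_le {Ω : Set (Rd d)} (hΩ : MeasurableSet Ω) {Φ ψ g : Rd d → ℝ}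
    (hΦ : IntegrableOn (fun x => Φ x * g x) Ω) (hψ : IntegrableOn (fun x => ψ x * g x) Ω)
    (hg : IntegrableOn g Ω) {ε : ℝ} (h : ∀ x ∈ Ω, |ψ x - Φ x| ≤ ε) :
    ∫ x in Ω, Φ x * g x ≤ (∫ x in Ω, ψ x * g x) + ε * ∫ x in Ω, |g x| := by
  rw [← integral_const_mul, ← integral_add hψ (hg.abs.const_mul ε)]
  refine setIntegral_mono_on hΦ (hψ.add (hg.abs.const_mul ε)) hΩ fun x hx => ?_
  have h1 : |(ψ x - Φ x) * g x| ≤ ε * |g x| := by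
    rw [abs_mul]
    exact mul_le_mul_of_nonneg_right (h x hx) (abs_nonneg _)
  have := (abs_le.1 h1).1
  have e : (ψ x - Φ x) * g x = ψ x * g x - Φ x * g x := sub_mul _ _ _
  linarith

theorem IsPotential.ofReal_integral_le_cost {Ω : Set (Rd d)} {μ₀ μ₁ : Rd d → ℝ}
    (hΩc : IsCompact Ω) (hΩ : Convex ℝ Ω) (hΩi : (interior Ω).Nonempty)
    (hμ₀ : IsDensity Ω μ₀) (hμ₁ : IsDensity Ω μ₁) {N : Seminorm ℝ (Rd d)}
    (hN : ∀ u, N u = 0 → u = 0) {α : ℝ} {Φ : Rd d → ℝ} (hΦ : IsPotential Ω N α Φ)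
    {ρ : ℝ → Rd d → ℝ} {v : ℝ → Rd d → Rd d} {f : ℝ → Rd d → ℝ}
    (hadm : IsAdmissible Ω μ₀ μ₁ ρ v f) :
    ENNReal.ofReal (∫ x in Ω, Φ x * (μ₁ x - μ₀ x)) ≤ cost Ω N α ρ v f := by
  rcases eq_or_ne (cost Ω N α ρ v f) ⊤ with htop | htop
  · simp [htop]
  -- Mollification near `∂Ω` uses values outside `Ω`, so the potential is first extended with its
  -- bounds.
  obtain ⟨Ψ, hΨ, hΨb, hΨΦ⟩ := exists_nLip_extension N (hΩi.mono interior_subset)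
    (fun x hx y hy => hΦ.sub_le hΩc hΩ hΩi hN hx hy) hΦ.abs_le
  have hg : IntegrableOn (fun x => μ₁ x - μ₀ x) Ω := hμ₁.integrable.sub hμ₀.integrable
  have hi : ∀ {Ψ : Rd d → ℝ}, Continuous Ψ →
      IntegrableOn (fun x => Ψ x * (μ₁ x - μ₀ x)) Ω := fun hc =>
    hg.continuousOn_mul hc.continuousOn hΩc
  have hΩm := hΩc.measurableSet
  rw [setIntegral_congr_fun hΩm (g := fun x => Ψ x * (μ₁ x - μ₀ x))
    fun x hx => by simp only [hΨΦ hx]]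
  refine ENNReal.ofReal_le_of_le_toReal (le_of_forall_pos_le_add fun ε hε => ?_)
  set A := ∫ x in Ω, |μ₁ x - μ₀ x| with hA
  have hA0 : 0 ≤ A := integral_nonneg fun _ => abs_nonneg _
  obtain ⟨ψ, hψ, hψN, hψb, hψΨ⟩ := hΨ.exists_smooth_approx hΨb (ε := ε / (A + 1)) (by positivity)
  have h1 := (ENNReal.ofReal_le_iff_le_toReal htop).1
    (hadm.ofReal_integral_le_cost_of_smooth hΩc hμ₀ hμ₁ hψ hψN hψb)
  have h2 := integral_mul_le_of_abs_sub_le hΩm (hi hΨ.continuous) (hi hψ.continuous) hg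
    (fun x _ => hψΨ x)
  have h3 : ε / (A + 1) * A ≤ ε := by
    rw [div_mul_eq_mul_div, div_le_iff₀ (by positivity)]
    nlinarith
  linarith

end WeakDuality

/-! ### From stationary flows to admissible paths -/

section Dynamics

variable {d : ℕ}

/-- `m` and `f` satisfy the stationary equation `g = -∇ ⬝ m + f` on `Ω` with zero flux through
`∂Ω`, in the weak sense. -/
structure IsFlow (Ω : Set (Rd d)) (g : Rd d → ℝ) (m : Rd d → Rd d) (f : Rd d → ℝ) : Prop where
  measurable_momentum : Measurable m
  measurable_source : Measurable f
  integrable_momentum : IntegrableOn m Ω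
  integrable_source : IntegrableOn f Ω
  equation : ∀ ψ : Rd d → ℝ, ContDiff ℝ ∞ ψ →
    ∫ x in Ω, ψ x * g x = ∫ x in Ω, (fderiv ℝ ψ x (m x) + ψ x * f x)

/-- The cost of a stationary flow. -/
noncomputable def flowCost (Ω : Set (Rd d)) (N : Seminorm ℝ (Rd d)) (α : ℝ) (m : Rd d → Rd d)
    (f : Rd d → ℝ) : ℝ :=
  (∫ x in Ω, N (m x)) + 1 / α * ∫ x in Ω, |f x|

lemma integrable_seminorm_comp {X : Type*} [MeasurableSpace X] {μ : Measure X}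
    (N : Seminorm ℝ (Rd d)) {m : X → Rd d} (hm : Integrable m μ) :
    Integrable (fun x => N (m x)) μ := by
  obtain ⟨K, hK⟩ := exists_seminorm_le N
  refine (hm.norm.const_mul (K : ℝ)).mono'
    ((continuous_seminorm N).comp_aestronglyMeasurable hm.aestronglyMeasurable)
    (Eventually.of_forall fun x => ?_)
  rw [Real.norm_of_nonneg (apply_nonneg N _)]
  exact hK _

lemma integrableOn_clm_apply {E F : Type*} [NormedAddCommGroup E] [NormedSpace ℝ E]
    [MeasurableSpace E] [BorelSpace E] [SecondCountableTopology E]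
    [NormedAddCommGroup F] [NormedSpace ℝ F] {S : Set E} (hS : IsCompact S)
    {μ : Measure E} {A : E → F →L[ℝ] ℝ} (hA : Continuous A) {m : E → F}
    (hm : IntegrableOn m S μ) : IntegrableOn (fun p => A p (m p)) S μ := by
  refine (IntegrableOn.continuousOn_mul (g := fun p => ‖A p‖) (g' := fun p => ‖m p‖)
    hA.norm.continuousOn hm.norm hS).mono' ?_
    (Eventually.of_forall fun p => (A p).le_opNorm _)
  exact (isBoundedBilinearMap_apply (𝕜 := ℝ) (E := F) (F := ℝ)).continuous.comp_aestronglyMeasurable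
    (hA.aestronglyMeasurable.prodMk hm.aestronglyMeasurable)

lemma IsDensity.exists_measurable_nonneg {Ω : Set (Rd d)} {μ : Rd d → ℝ} (h : IsDensity Ω μ) :
    ∃ a : Rd d → ℝ, Measurable a ∧ (∀ x, 0 ≤ a x) ∧ IntegrableOn a Ω ∧
      a =ᵐ[volume.restrict Ω] μ := by
  obtain ⟨b, hb, hbμ⟩ := h.integrable.aestronglyMeasurable.aemeasurable
  have hae : (fun x => max (b x) 0) =ᵐ[volume.restrict Ω] μ := by
    filter_upwards [hbμ, h.nonneg] with x hx h0
    rw [← hx, max_eq_left h0]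
  exact ⟨fun x => max (b x) 0, hb.max measurable_const, fun x => le_max_right _ _,
    h.integrable.congr hae.symm, hae⟩

/-- The density path from `a₀` to `a₁` which is positive at intermediate times. -/
def bridge (a₀ a₁ : Rd d → ℝ) (δ t : ℝ) (x : Rd d) : ℝ :=
  (1 - t) * a₀ x + t * a₁ x + δ * (t * (1 - t))

section

variable {a₀ a₁ : Rd d → ℝ} {δ : ℝ}

lemma bridge_pos (h₀ : ∀ x, 0 ≤ a₀ x) (h₁ : ∀ x, 0 ≤ a₁ x) (hδ : 0 < δ) {t : ℝ}
    (ht : t ∈ Ioo (0 : ℝ) 1) (x : Rd d) : 0 < bridge a₀ a₁ δ t x := by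
  have h1 : 0 < 1 - t := by linarith [ht.2]
  have h2 : 0 < δ * (t * (1 - t)) := mul_pos hδ (mul_pos ht.1 h1)
  have h3 := mul_nonneg h1.le (h₀ x)
  have h4 := mul_nonneg ht.1.le (h₁ x)
  unfold bridge
  linarith

lemma bridge_nonneg (h₀ : ∀ x, 0 ≤ a₀ x) (h₁ : ∀ x, 0 ≤ a₁ x) (hδ : 0 < δ) {t : ℝ}
    (ht : t ∈ Icc (0 : ℝ) 1) (x : Rd d) : 0 ≤ bridge a₀ a₁ δ t x := by
  have h1 : 0 ≤ 1 - t := by linarith [ht.2]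
  have h2 : 0 ≤ δ * (t * (1 - t)) := mul_nonneg hδ.le (mul_nonneg ht.1 h1)
  have h3 := mul_nonneg h1 (h₀ x)
  have h4 := mul_nonneg ht.1 (h₁ x)
  unfold bridge
  linarith

lemma measurable_bridge (h₀ : Measurable a₀) (h₁ : Measurable a₁) :
    Measurable fun p : ℝ × Rd d => bridge a₀ a₁ δ p.1 p.2 := by
  unfold bridge
  fun_prop

lemma integrableOn_bridge {Ω : Set (Rd d)} (hΩ : volume Ω ≠ ⊤) (h₀ : IntegrableOn a₀ Ω)
    (h₁ : IntegrableOn a₁ Ω) (t : ℝ) : IntegrableOn (bridge a₀ a₁ δ t) Ω :=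
  ((h₀.const_mul _).add (h₁.const_mul _)).add (integrableOn_const hΩ)

lemma hasDerivAt_bridge (x : Rd d) (t : ℝ) :
    HasDerivAt (fun t => bridge a₀ a₁ δ t x) (a₁ x - a₀ x + δ * (1 - 2 * t)) t := by
  unfold bridge
  have h1 := (((hasDerivAt_id t).const_sub 1).mul_const (a₀ x))
  have h2 := ((hasDerivAt_id t).mul_const (a₁ x))
  have h3 := (((hasDerivAt_id t).mul ((hasDerivAt_id t).const_sub 1)).const_mul δ)
  refine ((h1.add h2).add h3).congr_deriv ?_
  simp only [id]
  ring

lemma tendsto_bridge {Ω : Set (Rd d)} (hΩ : volume Ω ≠ ⊤) (h₀ : IntegrableOn a₀ Ω)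
    (h₁ : IntegrableOn a₁ Ω) (hδ : 0 < δ) {t : ℝ} (ht : t ∈ Icc (0 : ℝ) 1) :
    Tendsto (fun s => ∫ x in Ω, |bridge a₀ a₁ δ s x - bridge a₀ a₁ δ t x|)
      (𝓝[Icc (0 : ℝ) 1] t) (𝓝 0) := by
  have hi : IntegrableOn (fun x => |a₁ x - a₀ x| + δ) Ω :=
    (h₁.sub h₀).abs.add (integrableOn_const hΩ)
  have hlim : Tendsto (fun s => |s - t| * ∫ x in Ω, (|a₁ x - a₀ x| + δ)) (𝓝 t) (𝓝 0) :=
    Continuous.tendsto' (by fun_prop) _ _ (by simp)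
  refine squeeze_zero' (Eventually.of_forall fun s => integral_nonneg fun x => abs_nonneg _) ?_
    (hlim.mono_left nhdsWithin_le_nhds)
  filter_upwards [self_mem_nhdsWithin] with s hs
  rw [← integral_const_mul]
  refine integral_mono ((integrableOn_bridge hΩ h₀ h₁ s).sub (integrableOn_bridge hΩ h₀ h₁ t)).abs
    (hi.const_mul _) fun x => ?_
  have e : bridge a₀ a₁ δ s x - bridge a₀ a₁ δ t x
      = (s - t) * ((a₁ x - a₀ x) + δ * (1 - s - t)) := by unfold bridge; ring
  simp only [e, abs_mul]
  refine mul_le_mul_of_nonneg_left ((abs_add_le _ _).trans (add_le_add_right ?_ _)) (abs_nonneg _)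
  rw [abs_mul, abs_of_pos hδ]
  refine mul_le_of_le_one_right hδ.le (abs_le.2 ⟨?_, ?_⟩) <;> linarith [hs.1, hs.2, ht.1, ht.2]

/-- The integrand is the time derivative of `ψ * bridge`, and the `δ` term of `bridge` vanishes at
both ends. -/
lemma integral_time_bridge {ψ : ℝ × Rd d → ℝ} (hψ : ContDiff ℝ ∞ ψ) (x : Rd d) :
    ∫ t in Icc (0 : ℝ) 1, (fderiv ℝ ψ (t, x) (1, 0) * bridge a₀ a₁ δ t x
      + ψ (t, x) * (a₁ x - a₀ x + δ * (1 - 2 * t))) = ψ (1, x) * a₁ x - ψ (0, x) * a₀ x := by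
  rw [integral_Icc_eq_integral_Ioc, ← intervalIntegral.integral_of_le zero_le_one]
  have hψd : ∀ t, HasDerivAt (fun t => ψ (t, x)) (fderiv ℝ ψ (t, x) (1, 0)) t := fun t =>
    ((hψ.differentiable (by simp)) (t, x)).hasFDerivAt.comp_hasDerivAt t
      ((hasDerivAt_id t).prodMk (hasDerivAt_const t x))
  have hc : Continuous fun t : ℝ => fderiv ℝ ψ (t, x) (1, 0) :=
    ((hψ.continuous_fderiv (by simp)).comp (by fun_prop)).clm_apply continuous_const
  have hc' : Continuous fun t : ℝ => ψ (t, x) := hψ.continuous.comp (by fun_prop)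
  have hcb : Continuous fun t : ℝ => bridge a₀ a₁ δ t x := by unfold bridge; fun_prop
  rw [intervalIntegral.integral_eq_sub_of_hasDerivAt
    (f := fun t => ψ (t, x) * bridge a₀ a₁ δ t x)
    (fun t _ => (hψd t).mul (hasDerivAt_bridge x t))
    (Continuous.intervalIntegrable (by fun_prop) _ _)]
  simp [bridge]

end

lemma IsFlow.integral_slice {Ω : Set (Rd d)} {g : Rd d → ℝ} {m : Rd d → Rd d} {f : Rd d → ℝ}
    (h : IsFlow Ω g m f) {ψ : ℝ × Rd d → ℝ} (hψ : ContDiff ℝ ∞ ψ) (t : ℝ) :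
    ∫ x in Ω, ψ (t, x) * g x = ∫ x in Ω, (fderiv ℝ ψ (t, x) (0, m x) + ψ (t, x) * f x) := by
  rw [h.equation (fun x => ψ (t, x)) (hψ.comp (contDiff_prodMk_right t))]
  congr 1 with x
  have := ((hψ.differentiable (by simp)) (t, x)).hasFDerivAt.comp x
    (hasFDerivAt_prodMk_right (𝕜 := ℝ) t x)
  rw [show (fun x => ψ (t, x)) = ψ ∘ fun x => (t, x) from rfl, this.fderiv]
  rfl

variable {Ω : Set (Rd d)}

lemma restrict_Icc_prod (Ω : Set (Rd d)) :
    (volume : Measure (ℝ × Rd d)).restrict (Icc (0 : ℝ) 1 ×ˢ Ω)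
      = (volume.restrict (Icc (0 : ℝ) 1)).prod (volume.restrict Ω) := by
  rw [Measure.volume_eq_prod, Measure.prod_restrict]

lemma integrableOn_comp_fst (hΩ : volume Ω ≠ ⊤) {h : ℝ → ℝ} (hh : Continuous h) :
    IntegrableOn (fun p : ℝ × Rd d => h p.1) (Icc (0 : ℝ) 1 ×ˢ Ω) := by
  have : IsFiniteMeasure (volume.restrict Ω) := ⟨by simpa using hΩ.lt_top⟩
  rw [IntegrableOn, restrict_Icc_prod]
  exact (hh.continuousOn.integrableOn_compact isCompact_Icc).integrable.comp_fst _

lemma integrableOn_comp_snd {F : Type*} [NormedAddCommGroup F] {h : Rd d → F}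
    (hh : IntegrableOn h Ω) :
    IntegrableOn (fun p : ℝ × Rd d => h p.2) (Icc (0 : ℝ) 1 ×ˢ Ω) := by
  rw [IntegrableOn, restrict_Icc_prod]
  exact Integrable.comp_snd hh _

lemma integral_comp_snd (h : Rd d → ℝ) :
    ∫ p in Icc (0 : ℝ) 1 ×ˢ Ω, h p.2 = ∫ x in Ω, h x := by
  rw [restrict_Icc_prod, integral_fun_snd]
  simp

lemma integrableOn_bridge_prod (hΩc : IsCompact Ω) {a₀ a₁ : Rd d → ℝ} {δ : ℝ}
    (h₀ : IntegrableOn a₀ Ω) (h₁ : IntegrableOn a₁ Ω) :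
    IntegrableOn (fun p : ℝ × Rd d => bridge a₀ a₁ δ p.1 p.2) (Icc (0 : ℝ) 1 ×ˢ Ω) := by
  have hK : IsCompact (Icc (0 : ℝ) 1 ×ˢ Ω) := isCompact_Icc.prod hΩc
  unfold bridge
  refine (IntegrableOn.add (IntegrableOn.add ?_ ?_) ?_)
  · exact IntegrableOn.continuousOn_mul (by fun_prop) (integrableOn_comp_snd h₀) hK
  · exact IntegrableOn.continuousOn_mul (by fun_prop) (integrableOn_comp_snd h₁) hK
  · exact integrableOn_comp_fst hΩc.measure_ne_top (h := fun t => δ * (t * (1 - t))) (by fun_prop)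

/-- This is the sum of the fundamental theorem of calculus in `t`, integrated over `x`, and of the
stationary equation at fixed `t`, integrated over `t`. Both contain `∫ ψ (a₁ - a₀)`, which cancels.
-/
lemma IsFlow.weak_equation_bridge (hΩc : IsCompact Ω) {a₀ a₁ : Rd d → ℝ} {δ : ℝ}
    (h₀ : IntegrableOn a₀ Ω) (h₁ : IntegrableOn a₁ Ω) {m : Rd d → Rd d} {f : Rd d → ℝ}
    (h : IsFlow Ω (fun x => a₁ x - a₀ x) m f) {ψ : ℝ × Rd d → ℝ} (hψ : ContDiff ℝ ∞ ψ) :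
    (∫ x in Ω, ψ (1, x) * a₁ x) - (∫ x in Ω, ψ (0, x) * a₀ x) =
      ∫ p in Icc (0 : ℝ) 1 ×ˢ Ω, (fderiv ℝ ψ p (1, 0) * bridge a₀ a₁ δ p.1 p.2
        + fderiv ℝ ψ p (0, m p.2) + ψ p * (f p.2 + δ * (1 - 2 * p.1))) := by
  have hK : IsCompact (Icc (0 : ℝ) 1 ×ˢ Ω) := isCompact_Icc.prod hΩc
  have hΩm := hΩc.measure_ne_top (μ := volume)
  have hψc := hψ.continuous
  have hdc : Continuous fun p => fderiv ℝ ψ p := hψ.continuous_fderiv (by simp)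
  have hg : IntegrableOn (fun x => a₁ x - a₀ x) Ω := h₁.sub h₀
  have i1 : IntegrableOn (fun p : ℝ × Rd d => fderiv ℝ ψ p (1, 0) * bridge a₀ a₁ δ p.1 p.2)
      (Icc (0 : ℝ) 1 ×ˢ Ω) :=
    IntegrableOn.continuousOn_mul (by fun_prop) (integrableOn_bridge_prod hΩc h₀ h₁) hK
  have i2 : IntegrableOn (fun p : ℝ × Rd d => ψ p * (a₁ p.2 - a₀ p.2 + δ * (1 - 2 * p.1)))
      (Icc (0 : ℝ) 1 ×ˢ Ω) :=
    IntegrableOn.continuousOn_mul hψc.continuousOn ((integrableOn_comp_snd hg).add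
      (integrableOn_comp_fst hΩm (h := fun t => δ * (1 - 2 * t)) (by fun_prop))) hK
  have i3 : IntegrableOn (fun p : ℝ × Rd d => fderiv ℝ ψ p (0, m p.2)) (Icc (0 : ℝ) 1 ×ˢ Ω) :=
    integrableOn_clm_apply hK hdc
      ((integrable_zero _ _ _).prodMk (integrableOn_comp_snd h.integrable_momentum))
  have i4 : IntegrableOn (fun p : ℝ × Rd d => ψ p * f p.2) (Icc (0 : ℝ) 1 ×ˢ Ω) :=
    IntegrableOn.continuousOn_mul hψc.continuousOn
      (integrableOn_comp_snd h.integrable_source) hK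
  have i5 : IntegrableOn (fun p : ℝ × Rd d => ψ p * (a₁ p.2 - a₀ p.2)) (Icc (0 : ℝ) 1 ×ˢ Ω) :=
    IntegrableOn.continuousOn_mul hψc.continuousOn (integrableOn_comp_snd hg) hK
  have i12 : IntegrableOn (fun p : ℝ × Rd d => fderiv ℝ ψ p (1, 0) * bridge a₀ a₁ δ p.1 p.2
      + ψ p * (a₁ p.2 - a₀ p.2 + δ * (1 - 2 * p.1))) (Icc (0 : ℝ) 1 ×ˢ Ω) := i1.add i2
  have i34 : IntegrableOn (fun p : ℝ × Rd d => fderiv ℝ ψ p (0, m p.2) + ψ p * f p.2)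
      (Icc (0 : ℝ) 1 ×ˢ Ω) := i3.add i4
  have hslice : ∫ p in Icc (0 : ℝ) 1 ×ˢ Ω, (fderiv ℝ ψ p (0, m p.2) + ψ p * f p.2)
      = ∫ p in Icc (0 : ℝ) 1 ×ˢ Ω, ψ p * (a₁ p.2 - a₀ p.2) := by
    have j1 := i34
    have j2 := i5
    rw [IntegrableOn, restrict_Icc_prod] at j1 j2
    rw [restrict_Icc_prod, integral_prod _ j1, integral_prod _ j2]
    exact integral_congr_ae (Eventually.of_forall fun t => (h.integral_slice hψ t).symm)
  have htime : ∫ p in Icc (0 : ℝ) 1 ×ˢ Ω, (fderiv ℝ ψ p (1, 0) * bridge a₀ a₁ δ p.1 p.2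
      + ψ p * (a₁ p.2 - a₀ p.2 + δ * (1 - 2 * p.1)))
      = (∫ x in Ω, ψ (1, x) * a₁ x) - ∫ x in Ω, ψ (0, x) * a₀ x := by
    have j1 := i12
    rw [IntegrableOn, restrict_Icc_prod] at j1
    rw [restrict_Icc_prod, integral_prod_symm _ j1, ← integral_sub
      (IntegrableOn.continuousOn_mul (by fun_prop) h₁ hΩc)
      (IntegrableOn.continuousOn_mul (by fun_prop) h₀ hΩc)]
    exact integral_congr_ae (Eventually.of_forall fun x => integral_time_bridge hψ x)
  have hsplit : ∫ p in Icc (0 : ℝ) 1 ×ˢ Ω, (fderiv ℝ ψ p (1, 0) * bridge a₀ a₁ δ p.1 p.2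
        + fderiv ℝ ψ p (0, m p.2) + ψ p * (f p.2 + δ * (1 - 2 * p.1)))
      = (∫ p in Icc (0 : ℝ) 1 ×ˢ Ω, (fderiv ℝ ψ p (1, 0) * bridge a₀ a₁ δ p.1 p.2
          + ψ p * (a₁ p.2 - a₀ p.2 + δ * (1 - 2 * p.1))))
        + (∫ p in Icc (0 : ℝ) 1 ×ˢ Ω, (fderiv ℝ ψ p (0, m p.2) + ψ p * f p.2))
        - ∫ p in Icc (0 : ℝ) 1 ×ˢ Ω, ψ p * (a₁ p.2 - a₀ p.2) := by
    rw [← integral_add i12 i34]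
    refine Eq.trans ?_ (integral_sub (i12.add i34) i5)
    congr 1 with p
    ring
  rw [hsplit, hslice, htime, add_sub_cancel_right]

lemma IsFlow.exists_admissible (hΩc : IsCompact Ω) {μ₀ μ₁ : Rd d → ℝ}
    (hμ₀ : IsDensity Ω μ₀) (hμ₁ : IsDensity Ω μ₁) {m : Rd d → Rd d} {f : Rd d → ℝ}
    (h : IsFlow Ω (fun x => μ₁ x - μ₀ x) m f) (N : Seminorm ℝ (Rd d)) {α : ℝ} (hα : 0 < α)
    {δ : ℝ} (hδ : 0 < δ) :
    ∃ ρ v f', IsAdmissible Ω μ₀ μ₁ ρ v f' ∧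
      cost Ω N α ρ v f' ≤ ENNReal.ofReal (flowCost Ω N α m f + 1 / α * (δ * volume.real Ω)) := by
  obtain ⟨a₀, ha₀, hn₀, hi₀, he₀⟩ := hμ₀.exists_measurable_nonneg
  obtain ⟨a₁, ha₁, hn₁, hi₁, he₁⟩ := hμ₁.exists_measurable_nonneg
  have hΩm := hΩc.measure_ne_top (μ := volume)
  have hmm := h.measurable_momentum
  have hfm := h.measurable_source
  have ha : IsFlow Ω (fun x => a₁ x - a₀ x) m f :=
    { h with
      equation := fun ψ hψ => by
        rw [← h.equation ψ hψ]
        refine integral_congr_ae ?_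
        filter_upwards [he₀, he₁] with x h0 h1
        rw [h0, h1] }
  -- The density may vanish at `t = 0` and `t = 1`, but these times form a null set.
  have hIoo : ∀ᵐ p ∂((volume : Measure (ℝ × Rd d)).restrict (Icc (0 : ℝ) 1 ×ˢ Ω)),
      p.1 ∈ Ioo (0 : ℝ) 1 := by
    rw [restrict_Icc_prod, ← restrict_Ioo_eq_restrict_Icc]
    exact Measure.quasiMeasurePreserving_fst.ae (ae_restrict_mem measurableSet_Ioo)
  have hmom : (fun p : ℝ × Rd d => bridge a₀ a₁ δ p.1 p.2 • ((bridge a₀ a₁ δ p.1 p.2)⁻¹ • m p.2))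
      =ᵐ[volume.restrict (Icc (0 : ℝ) 1 ×ˢ Ω)] fun p => m p.2 := by
    filter_upwards [hIoo] with p hp
    rw [smul_smul, mul_inv_cancel₀ (bridge_pos hn₀ hn₁ hδ hp _).ne', one_smul]
  have hsrc : IntegrableOn (fun p : ℝ × Rd d => f p.2 + δ * (1 - 2 * p.1))
      (Icc (0 : ℝ) 1 ×ˢ Ω) :=
    (integrableOn_comp_snd h.integrable_source).add
      (integrableOn_comp_fst hΩm (h := fun t => δ * (1 - 2 * t)) (by fun_prop))
  have hbm := measurable_bridge (δ := δ) ha₀ ha₁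
  -- The velocity makes the momentum equal to `m` at almost every time; the extra source is the time
  -- derivative of the bump.
  refine ⟨bridge a₀ a₁ δ, fun t x => (bridge a₀ a₁ δ t x)⁻¹ • m x,
    fun t x => f x + δ * (1 - 2 * t), ?_, ?_⟩
  · refine ⟨hbm, hbm.inv.smul (hmm.comp measurable_snd), by fun_prop, fun t ht => ?_,
      fun t ht => tendsto_bridge hΩm hi₀ hi₁ hδ ht, ?_, ?_, ?_, hsrc, fun ψ hψ => ?_⟩
    · exact ⟨integrableOn_bridge hΩm hi₀ hi₁ t,
        Eventually.of_forall (bridge_nonneg hn₀ hn₁ hδ ht)⟩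
    · filter_upwards [he₀] with x hx
      simp [bridge, hx]
    · filter_upwards [he₁] with x hx
      simp [bridge, hx]
    · exact (integrableOn_comp_snd h.integrable_momentum).congr hmom.symm
    · have e₀ : ∫ x in Ω, ψ (0, x) * μ₀ x = ∫ x in Ω, ψ (0, x) * a₀ x :=
        integral_congr_ae (he₀.mono fun x hx => by simp only [hx])
      have e₁ : ∫ x in Ω, ψ (1, x) * μ₁ x = ∫ x in Ω, ψ (1, x) * a₁ x :=
        integral_congr_ae (he₁.mono fun x hx => by simp only [hx])
      rw [e₀, e₁, ha.weak_equation_bridge hΩc hi₀ hi₁ hψ (δ := δ)]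
      refine integral_congr_ae (hmom.mono fun p hp => ?_)
      simp only at hp ⊢
      rw [hp]
  · have hNi := integrable_seminorm_comp N h.integrable_momentum
    have c1 : ∫⁻ p in Icc (0 : ℝ) 1 ×ˢ Ω, ENNReal.ofReal
        (N ((bridge a₀ a₁ δ p.1 p.2)⁻¹ • m p.2) * bridge a₀ a₁ δ p.1 p.2)
        = ENNReal.ofReal (∫ x in Ω, N (m x)) := by
      rw [← integral_comp_snd (fun x => N (m x)), ofReal_integral_eq_lintegral_ofReal
        (integrableOn_comp_snd hNi) (Eventually.of_forall fun _ => apply_nonneg N _)]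
      refine lintegral_congr_ae (hIoo.mono fun p hp => ?_)
      have hp' := bridge_pos hn₀ hn₁ hδ hp p.2
      simp only
      rw [map_smul_eq_mul, norm_inv, Real.norm_of_nonneg hp'.le, mul_comm, ← mul_assoc,
        mul_inv_cancel₀ hp'.ne', one_mul]
    have c2 : ∫⁻ p in Icc (0 : ℝ) 1 ×ˢ Ω, ENNReal.ofReal |f p.2 + δ * (1 - 2 * p.1)|
        ≤ ENNReal.ofReal ((∫ x in Ω, |f x|) + δ * volume.real Ω) := by
      have hi : IntegrableOn (fun x => |f x| + δ) Ω :=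
        h.integrable_source.abs.add (integrableOn_const hΩm)
      have e : (∫ x in Ω, |f x|) + δ * volume.real Ω = ∫ x in Ω, (|f x| + δ) := by
        rw [integral_add h.integrable_source.abs (integrableOn_const hΩm)]
        simp [mul_comm]
      rw [e, ← integral_comp_snd (fun x => |f x| + δ), ofReal_integral_eq_lintegral_ofReal
        (integrableOn_comp_snd hi) (Eventually.of_forall fun _ => by positivity)]
      refine lintegral_mono_ae (hIoo.mono fun p hp => ENNReal.ofReal_le_ofReal ?_)
      refine (abs_add_le _ _).trans (add_le_add_right ?_ _)
      rw [abs_mul, abs_of_pos hδ]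
      refine mul_le_of_le_one_right hδ.le (abs_le.2 ⟨?_, ?_⟩) <;> linarith [hp.1, hp.2]
    have hα' : 0 ≤ 1 / α := by positivity
    rw [cost, c1, flowCost, add_assoc, ← mul_add, ENNReal.ofReal_add
      (integral_nonneg fun _ => apply_nonneg N _)
      (mul_nonneg hα' (add_nonneg (integral_nonneg fun _ => abs_nonneg _) (by positivity))),
      ENNReal.ofReal_mul hα']
    gcongr

end Dynamics

/-! ### Linearity of flows and sublinearity of their cost -/

section Flow

variable {d : ℕ} {Ω : Set (Rd d)}

lemma IsFlow.congr {g g' : Rd d → ℝ} {m : Rd d → Rd d} {f : Rd d → ℝ} (h : IsFlow Ω g m f)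
    (hg : g =ᵐ[volume.restrict Ω] g') : IsFlow Ω g' m f :=
  { h with
    equation := fun ψ hψ => by
      rw [← h.equation ψ hψ]
      exact integral_congr_ae (hg.mono fun x hx => by simp only [hx]) }

lemma IsFlow.integrableOn_rhs (hΩc : IsCompact Ω) {g : Rd d → ℝ} {m : Rd d → Rd d} {f : Rd d → ℝ}
    (h : IsFlow Ω g m f) {ψ : Rd d → ℝ} (hψ : ContDiff ℝ ∞ ψ) :
    IntegrableOn (fun x => fderiv ℝ ψ x (m x) + ψ x * f x) Ω :=
  (integrableOn_clm_apply hΩc (hψ.continuous_fderiv (by simp)) h.integrable_momentum).add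
    (IntegrableOn.continuousOn_mul hψ.continuous.continuousOn h.integrable_source hΩc)

lemma IsFlow.add (hΩc : IsCompact Ω) {g g' : Rd d → ℝ} (hg : IntegrableOn g Ω)
    (hg' : IntegrableOn g' Ω) {m m' : Rd d → Rd d} {f f' : Rd d → ℝ}
    (h : IsFlow Ω g m f) (h' : IsFlow Ω g' m' f') :
    IsFlow Ω (fun x => g x + g' x) (fun x => m x + m' x) (fun x => f x + f' x) where
  measurable_momentum := h.measurable_momentum.add h'.measurable_momentum
  measurable_source := h.measurable_source.add h'.measurable_source
  integrable_momentum := h.integrable_momentum.add h'.integrable_momentum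
  integrable_source := h.integrable_source.add h'.integrable_source
  equation := fun ψ hψ => by
    have hi : ∀ {g : Rd d → ℝ}, IntegrableOn g Ω → IntegrableOn (fun x => ψ x * g x) Ω :=
      fun hg => IntegrableOn.continuousOn_mul hψ.continuous.continuousOn hg hΩc
    simp only [mul_add, map_add]
    rw [integral_add (hi hg) (hi hg'), h.equation ψ hψ, h'.equation ψ hψ,
      ← integral_add (h.integrableOn_rhs hΩc hψ) (h'.integrableOn_rhs hΩc hψ)]
    congr 1 with x
    ring

lemma IsFlow.smul {g : Rd d → ℝ} {m : Rd d → Rd d} {f : Rd d → ℝ} (h : IsFlow Ω g m f) (c : ℝ) :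
    IsFlow Ω (fun x => c * g x) (fun x => c • m x) (fun x => c * f x) where
  measurable_momentum := h.measurable_momentum.const_smul c
  measurable_source := h.measurable_source.const_mul c
  integrable_momentum := h.integrable_momentum.smul c
  integrable_source := h.integrable_source.const_mul c
  equation := fun ψ hψ => by
    have e : ∀ x, ψ x * (c * g x) = c * (ψ x * g x) := fun x => by ring
    simp only [e]
    rw [integral_const_mul, h.equation ψ hψ, ← integral_const_mul]
    congr 1 with x
    rw [map_smul, smul_eq_mul]
    ring

lemma flowCost_nonneg (N : Seminorm ℝ (Rd d)) {α : ℝ} (hα : 0 < α) (m : Rd d → Rd d)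
    (f : Rd d → ℝ) : 0 ≤ flowCost Ω N α m f :=
  add_nonneg (integral_nonneg fun _ => apply_nonneg N _)
    (mul_nonneg (by positivity) (integral_nonneg fun _ => abs_nonneg _))

lemma flowCost_add_le (N : Seminorm ℝ (Rd d)) {α : ℝ} (hα : 0 < α) {m m' : Rd d → Rd d}
    {f f' : Rd d → ℝ} (hm : IntegrableOn m Ω) (hm' : IntegrableOn m' Ω) (hf : IntegrableOn f Ω)
    (hf' : IntegrableOn f' Ω) :
    flowCost Ω N α (fun x => m x + m' x) (fun x => f x + f' x)
      ≤ flowCost Ω N α m f + flowCost Ω N α m' f' := by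
  have h1 : ∫ x in Ω, N (m x + m' x) ≤ (∫ x in Ω, N (m x)) + ∫ x in Ω, N (m' x) := by
    rw [← integral_add (integrable_seminorm_comp N hm) (integrable_seminorm_comp N hm')]
    exact integral_mono (integrable_seminorm_comp N (hm.add hm'))
      ((integrable_seminorm_comp N hm).add (integrable_seminorm_comp N hm'))
      fun x => map_add_le_add N _ _
  have h2 : ∫ x in Ω, |f x + f' x| ≤ (∫ x in Ω, |f x|) + ∫ x in Ω, |f' x| := by
    rw [← integral_add hf.abs hf'.abs]
    exact integral_mono (hf.add hf').abs (hf.abs.add hf'.abs) fun x => abs_add_le _ _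
  have h3 := mul_le_mul_of_nonneg_left h2 (by positivity : 0 ≤ 1 / α)
  unfold flowCost
  linarith

lemma flowCost_smul (N : Seminorm ℝ (Rd d)) (α : ℝ) (m : Rd d → Rd d) (f : Rd d → ℝ) (c : ℝ) :
    flowCost Ω N α (fun x => c • m x) (fun x => c * f x) = |c| * flowCost Ω N α m f := by
  unfold flowCost
  simp only [map_smul_eq_mul, abs_mul, Real.norm_eq_abs, integral_const_mul]
  ring

/-- Creating everything by the source, without transport, pays for any error that is small in `L¹`.
-/
lemma exists_isFlow_of_source {k : Rd d → ℝ} (hk : IntegrableOn k Ω) (N : Seminorm ℝ (Rd d))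
    (α : ℝ) : ∃ m f, IsFlow Ω k m f ∧ flowCost Ω N α m f = 1 / α * ∫ x in Ω, |k x| := by
  obtain ⟨f, hf, hfk⟩ := hk.aestronglyMeasurable.aemeasurable
  refine ⟨fun _ => 0, f, ⟨measurable_const, hf, integrableOn_zero, hk.congr hfk, fun ψ _ => ?_⟩, ?_⟩
  · refine integral_congr_ae (hfk.mono fun x hx => ?_)
    simp [hx]
  · have : ∫ x in Ω, |f x| = ∫ x in Ω, |k x| :=
      integral_congr_ae (hfk.mono fun x hx => by simp only [hx])
    simp [flowCost, this]

end Flow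

/-! ### Transport of a ball along a segment -/

section Translation

variable {d : ℕ} {Ω : Set (Rd d)}

lemma setIntegral_closedBall_eq (φ : Rd d → ℝ) (c : Rd d) (r : ℝ) :
    ∫ z in Metric.closedBall c r, φ z = ∫ w in Metric.closedBall (0 : Rd d) r, φ (c + w) := by
  have h := (measurePreserving_add_left (volume : Measure (Rd d)) c).setIntegral_preimage_emb
    (MeasurableEquiv.addLeft c).measurableEmbedding φ (Metric.closedBall c r)
  rw [← h]
  congr 2
  ext w
  simp [dist_eq_norm]

/-- The time which the ball of radius `r` moving from `y` to `x` at constant speed spends at `z`. -/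
noncomputable def sojourn (x y : Rd d) (r : ℝ) (z : Rd d) : ℝ :=
  ∫ s in Icc (0 : ℝ) 1,
    {p : Rd d × ℝ | p.1 ∈ Metric.closedBall (y + p.2 • (x - y)) r}.indicator 1 (z, s)

lemma measurableSet_moving_ball (x y : Rd d) (r : ℝ) :
    MeasurableSet {p : Rd d × ℝ | p.1 ∈ Metric.closedBall (y + p.2 • (x - y)) r} :=
  (isClosed_le (by fun_prop : Continuous fun p : Rd d × ℝ => dist p.1 (y + p.2 • (x - y)))
    continuous_const).measurableSet

lemma measurable_sojourn (x y : Rd d) (r : ℝ) : Measurable (sojourn x y r) :=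
  (((measurable_one.indicator (measurableSet_moving_ball x y r)).stronglyMeasurable).integral_prod_right
    (f := fun z s => {p : Rd d × ℝ | p.1 ∈ Metric.closedBall (y + p.2 • (x - y)) r}.indicator 1
      (z, s))).measurable

lemma sojourn_nonneg (x y : Rd d) (r : ℝ) (z : Rd d) : 0 ≤ sojourn x y r z :=
  integral_nonneg fun _ => indicator_nonneg (fun _ _ => zero_le_one) _

/-- Fubini exchanges the time spent at a point for the motion of each point `w` of the ball.
Convexity keeps the moving ball inside `Ω`. -/
lemma integral_mul_sojourn (hΩc : IsCompact Ω) (hΩ : Convex ℝ Ω) {x y : Rd d} {r : ℝ}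
    (hx : Metric.closedBall x r ⊆ Ω) (hy : Metric.closedBall y r ⊆ Ω) {φ : Rd d → ℝ}
    (hφ : Continuous φ) :
    IntegrableOn (fun z => φ z * sojourn x y r z) Ω ∧
    ∫ z in Ω, φ z * sojourn x y r z =
      ∫ w in Metric.closedBall (0 : Rd d) r, ∫ s in Icc (0 : ℝ) 1, φ (y + s • (x - y) + w) := by
  set D := {p : Rd d × ℝ | p.1 ∈ Metric.closedBall (y + p.2 • (x - y)) r} with hD
  have hDm : MeasurableSet D := measurableSet_moving_ball x y r
  have hsub : ∀ s ∈ Icc (0 : ℝ) 1, Metric.closedBall (y + s • (x - y)) r ⊆ Ω := fun s hs z hz => by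
    have h1 : x + (z - (y + s • (x - y))) ∈ Ω := hx (by simpa [dist_eq_norm] using hz)
    have h2 : y + (z - (y + s • (x - y))) ∈ Ω := hy (by simpa [dist_eq_norm] using hz)
    have h3 := hΩ.add_smul_sub_mem h2 h1 hs
    rw [add_sub_add_right_eq_sub] at h3
    convert h3 using 1
    abel
  have hi : Integrable (fun p : Rd d × ℝ => φ p.1 * D.indicator 1 p)
      ((volume.restrict Ω).prod (volume.restrict (Icc (0 : ℝ) 1))) := by
    rw [Measure.prod_restrict, ← Measure.volume_eq_prod]
    have h0 : IntegrableOn (fun p : Rd d × ℝ => φ p.1) (Ω ×ˢ Icc (0 : ℝ) 1) :=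
      (hφ.comp continuous_fst).continuousOn.integrableOn_compact (hΩc.prod isCompact_Icc)
    refine (h0.integrable.indicator hDm).congr (Eventually.of_forall fun p => ?_)
    by_cases hp : p ∈ D <;> simp [hp]
  have hint : ∀ z, ∫ s in Icc (0 : ℝ) 1, φ z * D.indicator 1 (z, s) = φ z * sojourn x y r z :=
    fun z => by rw [integral_const_mul]; rfl
  have hi' := hi.integral_prod_left
  simp only [hint] at hi'
  refine ⟨hi', ?_⟩
  have hc : Continuous fun p : ℝ × Rd d => φ (y + p.1 • (x - y) + p.2) := by fun_prop
  have hi2 : Integrable (fun p : ℝ × Rd d => φ (y + p.1 • (x - y) + p.2))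
      ((volume.restrict (Icc (0 : ℝ) 1)).prod (volume.restrict (Metric.closedBall (0 : Rd d) r))) := by
    rw [Measure.prod_restrict, ← Measure.volume_eq_prod]
    exact hc.continuousOn.integrableOn_compact (isCompact_Icc.prod (isCompact_closedBall _ _))
  calc ∫ z in Ω, φ z * sojourn x y r z
      = ∫ z in Ω, ∫ s in Icc (0 : ℝ) 1, φ z * D.indicator 1 (z, s) := by simp only [hint]
    _ = ∫ s in Icc (0 : ℝ) 1, ∫ z in Ω, φ z * D.indicator 1 (z, s) :=
        integral_integral_swap hi
    _ = ∫ s in Icc (0 : ℝ) 1, ∫ w in Metric.closedBall (0 : Rd d) r, φ (y + s • (x - y) + w) := by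
        refine setIntegral_congr_fun measurableSet_Icc fun s hs => ?_
        rw [← setIntegral_closedBall_eq]
        have e : (fun z => φ z * D.indicator 1 (z, s))
            = (Metric.closedBall (y + s • (x - y)) r).indicator φ := by
          ext z
          by_cases hz : z ∈ Metric.closedBall (y + s • (x - y)) r
          · have : (z, s) ∈ D := hz
            simp only [indicator_of_mem this, indicator_of_mem hz, Pi.one_apply, mul_one]
          · have : (z, s) ∉ D := hz
            simp only [indicator_of_notMem this, indicator_of_notMem hz, mul_zero]
        rw [e, setIntegral_indicator Metric.isClosed_closedBall.measurableSet,
          inter_eq_self_of_subset_right (hsub s hs)]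
    _ = _ := integral_integral_swap hi2

/-- Moving a ball at constant speed from `y` to `x` costs `N (x - y)` per unit of mass. -/
lemma exists_isFlow_translation (hΩc : IsCompact Ω) (hΩ : Convex ℝ Ω) {x y : Rd d} {r : ℝ}
    (hx : Metric.closedBall x r ⊆ Ω) (hy : Metric.closedBall y r ⊆ Ω) (N : Seminorm ℝ (Rd d))
    (α : ℝ) :
    ∃ m f, IsFlow Ω (fun z => (Metric.closedBall x r).indicator 1 z
        - (Metric.closedBall y r).indicator 1 z) m f ∧
      flowCost Ω N α m f = N (x - y) * volume.real (Metric.closedBall (0 : Rd d) r) := by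
  have hone := integral_mul_sojourn hΩc hΩ hx hy (φ := fun _ => 1) continuous_const
  simp only [one_mul] at hone
  -- The momentum is the occupation density times the constant velocity. The equation then reduces
  -- to integrating the derivative of `ψ` along each trajectory from `y + w` to `x + w`.
  refine ⟨fun z => sojourn x y r z • (x - y), fun _ => 0, ⟨(measurable_sojourn x y r).smul_const _,
    measurable_const, hone.1.smul_const _, integrableOn_zero, fun ψ hψ => ?_⟩, ?_⟩
  · have hb : ∀ c : Rd d, Metric.closedBall c r ⊆ Ω →
        IntegrableOn (fun z => ψ z * (Metric.closedBall c r).indicator 1 z) Ω ∧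
        ∫ z in Ω, ψ z * (Metric.closedBall c r).indicator 1 z
          = ∫ w in Metric.closedBall (0 : Rd d) r, ψ (c + w) := fun c hc => by
      have e : (fun z => ψ z * (Metric.closedBall c r).indicator 1 z)
          = (Metric.closedBall c r).indicator ψ := by
        ext z
        by_cases hz : z ∈ Metric.closedBall c r
        · simp only [indicator_of_mem hz, Pi.one_apply, mul_one]
        · simp only [indicator_of_notMem hz, mul_zero]
      rw [e, setIntegral_indicator Metric.isClosed_closedBall.measurableSet,
        inter_eq_self_of_subset_right hc, setIntegral_closedBall_eq]
      exact ⟨(hψ.continuous.continuousOn.integrableOn_compact hΩc).indicator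
        Metric.isClosed_closedBall.measurableSet, rfl⟩
    have hib : ∀ c : Rd d, IntegrableOn (fun w => ψ (c + w)) (Metric.closedBall (0 : Rd d) r) :=
      fun c => (hψ.continuous.comp (by fun_prop)).continuousOn.integrableOn_compact
        (isCompact_closedBall _ _)
    have hdc : Continuous fun z => fderiv ℝ ψ z (x - y) :=
      (hψ.continuous_fderiv (by simp)).clm_apply continuous_const
    simp only [mul_sub, mul_zero, add_zero, map_smul, smul_eq_mul]
    rw [integral_sub (hb x hx).1 (hb y hy).1, (hb x hx).2, (hb y hy).2,
      ← integral_sub (hib x) (hib y)]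
    simp only [mul_comm (sojourn x y r _)]
    rw [(integral_mul_sojourn hΩc hΩ hx hy hdc).2]
    refine integral_congr_ae (Eventually.of_forall fun w => ?_)
    simp only
    rw [integral_Icc_eq_integral_Ioc, ← intervalIntegral.integral_of_le zero_le_one]
    have hd : ∀ s : ℝ, HasDerivAt (fun s : ℝ => ψ (y + s • (x - y) + w))
        (fderiv ℝ ψ (y + s • (x - y) + w) (x - y)) s := fun s => by
      have hγ := (((hasDerivAt_id s).smul_const (x - y)).const_add y).add_const w
      rw [one_smul] at hγ
      exact ((hψ.differentiable (by simp)) _).hasFDerivAt.comp_hasDerivAt s hγ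
    rw [intervalIntegral.integral_eq_sub_of_hasDerivAt (fun s _ => hd s)
      ((hdc.comp (by fun_prop)).intervalIntegrable _ _)]
    simp
  · simp only [flowCost, map_smul_eq_mul, Real.norm_of_nonneg (sojourn_nonneg x y r _),
      integral_mul_const, hone.2]
    simp [mul_comm]

end Translation

/-! ### Strong duality by Hahn–Banach separation -/

section StrongDuality

variable {d : ℕ} {Ω : Set (Rd d)}

lemma exists_integral_abs_le_mul_norm {X : Type*} [MeasurableSpace X] (ν : Measure X)
    [IsFiniteMeasure ν] : ∃ C : ℝ, 0 ≤ C ∧ ∀ u : Lp ℝ 2 ν, ∫ x, |u x| ∂ν ≤ C * ‖u‖ := by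
  refine ⟨(ν univ ^ ((1 : ℝ) / ENNReal.toReal 1 - 1 / ENNReal.toReal 2)).toReal,
    ENNReal.toReal_nonneg, fun u => ?_⟩
  have hu := Lp.aestronglyMeasurable u
  have hpow : ν univ ^ ((1 : ℝ) / ENNReal.toReal 1 - 1 / ENNReal.toReal 2) ≠ ⊤ :=
    ENNReal.rpow_ne_top_of_nonneg (by norm_num) (measure_ne_top _ _)
  have h := eLpNorm_le_eLpNorm_mul_rpow_measure_univ (p := 1) (q := 2) (by norm_num) hu
  have e : ∫ x, |u x| ∂ν = (eLpNorm u 1 ν).toReal := by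
    rw [eLpNorm_one_eq_lintegral_enorm, ← integral_norm_eq_lintegral_enorm hu]
    rfl
  rw [e, mul_comm, Lp.norm_def, ← ENNReal.toReal_mul]
  exact ENNReal.toReal_mono (ENNReal.mul_ne_top (Lp.eLpNorm_ne_top u) hpow) h

lemma integrableOn_of_Lp_two (hΩ : volume Ω ≠ ⊤) (u : Lp ℝ 2 (volume.restrict Ω)) :
    IntegrableOn u Ω := by
  have : IsFiniteMeasure (volume.restrict Ω) := ⟨by simpa using hΩ.lt_top⟩
  exact (Lp.memLp u).integrable (by norm_num)

/-- The square integrable functions which are driven by a flow of cost less than `r`. -/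
def flowSublevel (Ω : Set (Rd d)) (N : Seminorm ℝ (Rd d)) (α r : ℝ) :
    Set (Lp ℝ 2 (volume.restrict Ω)) :=
  {u | ∃ m f, IsFlow Ω u m f ∧ flowCost Ω N α m f < r}

lemma convex_flowSublevel (hΩc : IsCompact Ω) (N : Seminorm ℝ (Rd d)) {α : ℝ} (hα : 0 < α)
    (r : ℝ) : Convex ℝ (flowSublevel Ω N α r) := by
  rintro u ⟨m, f, h, hc⟩ u' ⟨m', f', h', hc'⟩ a b ha hb hab
  have hu := integrableOn_of_Lp_two hΩc.measure_ne_top u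
  have hu' := integrableOn_of_Lp_two hΩc.measure_ne_top u'
  have H := (h.smul a).add hΩc (hu.const_mul a) (hu'.const_mul b) (h'.smul b)
  refine ⟨_, _, H.congr ?_, ?_⟩
  · filter_upwards [Lp.coeFn_add (a • u) (b • u'), Lp.coeFn_smul a u, Lp.coeFn_smul b u']
      with x h1 h2 h3
    rw [h1, Pi.add_apply, h2, h3]
    rfl
  · refine (flowCost_add_le N hα (h.smul a).integrable_momentum (h'.smul b).integrable_momentum
      (h.smul a).integrable_source (h'.smul b).integrable_source).trans_lt ?_
    rw [flowCost_smul, flowCost_smul, abs_of_nonneg ha, abs_of_nonneg hb]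
    exact (convex_Iio r) hc hc' ha hb hab

/-- A perturbation is absorbed by a source, whose cost is controlled by its `L¹` norm and so, `Ω`
having finite measure, by its `L²` norm. -/
lemma isOpen_flowSublevel (hΩc : IsCompact Ω) (N : Seminorm ℝ (Rd d)) {α : ℝ} (hα : 0 < α)
    (r : ℝ) : IsOpen (flowSublevel Ω N α r) := by
  have hΩm := hΩc.measure_ne_top (μ := volume)
  have : IsFiniteMeasure (volume.restrict Ω) := ⟨by simpa using hΩm.lt_top⟩
  obtain ⟨C, hC, hCu⟩ := exists_integral_abs_le_mul_norm (volume.restrict Ω)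
  rw [Metric.isOpen_iff]
  rintro u ⟨m, f, h, hc⟩
  refine ⟨(r - flowCost Ω N α m f) / (1 / α * C + 1), div_pos (sub_pos.2 hc) (by positivity),
    fun u' hu' => ?_⟩
  have hu := integrableOn_of_Lp_two hΩm u
  have hk := integrableOn_of_Lp_two hΩm (u' - u)
  obtain ⟨m', f', h', hc'⟩ := exists_isFlow_of_source hk N α
  refine ⟨_, _, (h.add hΩc hu hk h').congr ?_, ?_⟩
  · filter_upwards [Lp.coeFn_sub u' u] with x hx
    rw [hx, Pi.sub_apply, add_sub_cancel]
  · refine (flowCost_add_le N hα h.integrable_momentum h'.integrable_momentum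
      h.integrable_source h'.integrable_source).trans_lt ?_
    rw [Metric.mem_ball, dist_eq_norm, lt_div_iff₀ (by positivity)] at hu'
    have h1 := mul_le_mul_of_nonneg_left (hCu (u' - u)) (by positivity : 0 ≤ 1 / α)
    rw [hc']
    nlinarith [norm_nonneg (u' - u)]

/-- The Hahn–Banach separation of a function from those driven by cheaper flows. -/
lemma exists_dual_function (hΩc : IsCompact Ω) (N : Seminorm ℝ (Rd d)) {α : ℝ} (hα : 0 < α)
    {r : ℝ} (hr : 0 < r) {h : Rd d → ℝ} (hh : MemLp h 2 (volume.restrict Ω))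
    (hno : ∀ m f, IsFlow Ω h m f → r ≤ flowCost Ω N α m f) :
    ∃ φ : Rd d → ℝ, IntegrableOn φ Ω ∧ ∫ x in Ω, φ x * h x = r ∧
      ∀ u : Rd d → ℝ, MemLp u 2 (volume.restrict Ω) → ∀ m f, IsFlow Ω u m f →
        ∫ x in Ω, φ x * u x ≤ flowCost Ω N α m f := by
  have hnot : hh.toLp h ∉ flowSublevel Ω N α r := by
    rintro ⟨m, f, hf, hc⟩
    exact absurd (hno m f (hf.congr hh.coeFn_toLp)) (not_le.2 hc)
  obtain ⟨l, hl⟩ := geometric_hahn_banach_open_point (convex_flowSublevel hΩc N hα r)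
    (isOpen_flowSublevel hΩc N hα r) hnot
  set L := l (hh.toLp h) with hL
  -- Separation from `0` makes `L` positive, so the functional can be rescaled to take the value `r`
  -- at `h`.
  have hzero : (0 : Lp ℝ 2 (volume.restrict Ω)) ∈ flowSublevel Ω N α r := by
    refine ⟨fun _ => 0, fun _ => 0, ⟨measurable_const, measurable_const, integrableOn_zero,
      integrableOn_zero, fun ψ _ => integral_congr_ae ?_⟩, by simpa [flowCost] using hr⟩
    filter_upwards [Lp.coeFn_zero ℝ 2 (volume.restrict Ω)] with x hx
    simp only [hx]
    simp
  have hLpos : 0 < L := by simpa using hl 0 hzero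
  set w := (InnerProductSpace.toDual ℝ (Lp ℝ 2 (volume.restrict Ω))).symm ((r / L) • l) with hw
  have hint : ∀ (u : Rd d → ℝ) (hu : MemLp u 2 (volume.restrict Ω)),
      ∫ x in Ω, w x * u x = r / L * l (hu.toLp u) := fun u hu => by
    have h1 : ⟪w, hu.toLp u⟫_ℝ = r / L * l (hu.toLp u) := by
      rw [hw, InnerProductSpace.toDual_symm_apply]
      rfl
    rw [← h1, L2.inner_def]
    refine integral_congr_ae (hu.coeFn_toLp.mono fun x hx => ?_)
    simp only [hx]
    simp [mul_comm]
  refine ⟨w, integrableOn_of_Lp_two hΩc.measure_ne_top w, ?_, fun u hu m f hf => ?_⟩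
  · rw [hint h hh, ← hL, div_mul_cancel₀ _ hLpos.ne']
  · rw [hint u hu]
    refine le_of_forall_pos_le_add fun ε hε => ?_
    have hc0 := flowCost_nonneg (Ω := Ω) N hα m f
    have hcε : 0 < flowCost Ω N α m f + ε := by linarith
    -- This factor brings the cost of `u` below `r`; the `ε` covers flows of zero cost.
    set k := r / (flowCost Ω N α m f + ε) with hk
    have hk0 : 0 < k := by positivity
    have hmem : k • hu.toLp u ∈ flowSublevel Ω N α r := by
      refine ⟨_, _, (hf.smul k).congr ?_, ?_⟩
      · filter_upwards [Lp.coeFn_smul k (hu.toLp u), hu.coeFn_toLp] with x h1 h2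
        rw [h1, Pi.smul_apply, h2, smul_eq_mul]
      · rw [flowCost_smul, abs_of_pos hk0, hk, div_mul_eq_mul_div, div_lt_iff₀ hcε]
        nlinarith
    have h1 := hl _ hmem
    rw [map_smul, smul_eq_mul, hk, div_mul_eq_mul_div, div_lt_iff₀ hcε] at h1
    rw [div_mul_eq_mul_div, div_le_iff₀ hLpos]
    linarith

lemma setIntegral_mul_indicator_one (φ : Rd d → ℝ) {B : Set (Rd d)} (hB : MeasurableSet B)
    (hBΩ : B ⊆ Ω) : ∫ x in Ω, φ x * B.indicator 1 x = ∫ x in B, φ x := by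
  have e : (fun x => φ x * B.indicator 1 x) = B.indicator φ := by
    ext x
    by_cases hx : x ∈ B <;> simp [hx]
  rw [e, setIntegral_indicator hB, inter_eq_self_of_subset_right hBΩ]

lemma ae_mem_interior (hΩc : IsCompact Ω) (hΩ : Convex ℝ Ω) :
    ∀ᵐ x ∂(volume.restrict Ω), x ∈ interior Ω := by
  rw [ae_restrict_iff' hΩc.measurableSet]
  filter_upwards [measure_eq_zero_iff_ae_notMem.1 (hΩ.addHaar_frontier volume)] with x hx hxΩ
  by_contra hxi
  exact hx ⟨subset_closure hxΩ, hxi⟩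

/-- A bounded functional on square integrable functions which is dominated by the flow cost is
represented by a potential. -/
lemma exists_nLip_of_dual_function (hΩc : IsCompact Ω) (hΩ : Convex ℝ Ω)
    (hΩi : (interior Ω).Nonempty) (N : Seminorm ℝ (Rd d)) {α : ℝ} {φ : Rd d → ℝ}
    (hφ : IntegrableOn φ Ω)
    (hdual : ∀ u : Rd d → ℝ, MemLp u 2 (volume.restrict Ω) → ∀ m f, IsFlow Ω u m f →
        ∫ x in Ω, φ x * u x ≤ flowCost Ω N α m f) :
    ∃ Φ : Rd d → ℝ, NLip N Φ ∧ (∀ x, |Φ x| ≤ 1 / α) ∧ Φ =ᵐ[volume.restrict Ω] φ := by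
  have hΩm := hΩc.measure_ne_top (μ := volume)
  have hfin : IsFiniteMeasure (volume.restrict Ω) := ⟨by simpa using hΩm.lt_top⟩
  -- Interior points where `φ` is the limit of its averages over centred balls: almost all of `Ω`,
  -- by Lebesgue differentiation and because a convex set has null frontier.
  set G : Set (Rd d) := {x | x ∈ interior Ω ∧
    Tendsto (fun s => ⨍ z in Metric.closedBall x s, Ω.indicator φ z) (𝓝[>] 0) (𝓝 (φ x))} with hG
  have hGae : ∀ᵐ x ∂(volume.restrict Ω), x ∈ G := by
    have hloc : LocallyIntegrable (Ω.indicator φ) volume :=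
      (hφ.integrable_indicator hΩc.measurableSet).locallyIntegrable
    filter_upwards [ae_mem_interior hΩc hΩ, ae_restrict_of_ae
      (IsUnifLocDoublingMeasure.ae_tendsto_average volume hloc 1)] with x hx hx'
    refine ⟨hx, ?_⟩
    have := hx' (fun _ : ℝ => x) id tendsto_id (by
      filter_upwards [self_mem_nhdsWithin] with s hs
      exact Metric.mem_closedBall_self (by simpa using (mem_Ioi.1 hs).le))
    rwa [indicator_of_mem (interior_subset hx)] at this
  have hball : ∀ x ∈ interior Ω, ∀ᶠ s in 𝓝[>] (0 : ℝ), 0 < s ∧ Metric.closedBall x s ⊆ Ω :=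
    fun x hx => by
      obtain ⟨s₀, hs₀, hs⟩ := Metric.nhds_basis_closedBall.mem_iff.1 (mem_interior_iff_mem_nhds.1 hx)
      filter_upwards [Ioo_mem_nhdsGT hs₀] with s hs'
      exact ⟨hs'.1, (Metric.closedBall_subset_closedBall hs'.2.le).trans hs⟩
  have hmeas : ∀ x s, MeasurableSet (Metric.closedBall (x : Rd d) s) := fun x s =>
    Metric.isClosed_closedBall.measurableSet
  have hvol : ∀ (x : Rd d) (s : ℝ), volume.real (Metric.closedBall x s)
      = volume.real (Metric.closedBall (0 : Rd d) s) := fun x s => by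
    rw [measureReal_def, measureReal_def, Measure.addHaar_closedBall_center]
  have hpos : ∀ s : ℝ, 0 < s → 0 < volume.real (Metric.closedBall (0 : Rd d) s) := fun s hs =>
    ENNReal.toReal_pos (Metric.measure_closedBall_pos _ _ hs).ne' measure_closedBall_lt_top.ne
  have hmem : ∀ (x : Rd d) (s : ℝ), MemLp (fun z => (Metric.closedBall x s).indicator 1 z : Rd d → ℝ)
      2 (volume.restrict Ω) := fun x s =>
    memLp_indicator_const 2 (hmeas x s) (1 : ℝ) (Or.inr (measure_ne_top _ _))
  have havg : ∀ x s, Metric.closedBall x s ⊆ Ω → ⨍ z in Metric.closedBall x s, Ω.indicator φ z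
      = (∫ z in Ω, φ z * (Metric.closedBall x s).indicator 1 z)
        / volume.real (Metric.closedBall (0 : Rd d) s) := fun x s hs => by
    rw [setIntegral_mul_indicator_one φ (hmeas x s) hs, setAverage_eq, hvol, smul_eq_mul,
      inv_mul_eq_div, setIntegral_congr_fun (hmeas x s) fun z hz => indicator_of_mem (hs hz) φ]
  have hiφ : ∀ x s, IntegrableOn (fun z => φ z * (Metric.closedBall x s).indicator 1 z) Ω :=
    fun x s => by
      refine (hφ.integrable.indicator (hmeas x s)).congr (Eventually.of_forall fun z => ?_)
      by_cases hz : z ∈ Metric.closedBall x s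
      · simp only [indicator_of_mem hz, Pi.one_apply, mul_one]
      · simp only [indicator_of_notMem hz, mul_zero]
  -- Test with the flow moving a ball from `y` to `x`, divide by its volume and shrink it.
  have hlip : ∀ x ∈ G, ∀ y ∈ G, φ x - φ y ≤ N (x - y) := fun x hx y hy => by
    refine le_of_tendsto (hx.2.sub hy.2) ?_
    filter_upwards [hball x hx.1, hball y hy.1] with s hsx hsy
    obtain ⟨m, f, hflow, hcost⟩ := exists_isFlow_translation hΩc hΩ hsx.2 hsy.2 N α
    have h1 := hdual _ ((hmem x s).sub (hmem y s)) m f hflow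
    rw [hcost] at h1
    simp only [Pi.sub_apply, mul_sub] at h1
    rw [integral_sub (hiφ x s) (hiφ y s)] at h1
    rw [havg x s hsx.2, havg y s hsy.2, ← sub_div, div_le_iff₀ (hpos s hsx.1)]
    exact h1
  -- Test with a source creating plus or minus the indicator of a shrinking ball.
  have hbdd : ∀ x ∈ G, |φ x| ≤ 1 / α := fun x hx => by
    refine le_of_tendsto hx.2.abs ?_
    filter_upwards [hball x hx.1] with s hs
    have hsource : ∀ c : ℝ, |c| = 1 →
        c * ∫ z in Ω, φ z * (Metric.closedBall x s).indicator 1 z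
          ≤ 1 / α * volume.real (Metric.closedBall (0 : Rd d) s) := fun c hc => by
      have hm := (hmem x s).const_mul c
      obtain ⟨m, f, hflow, hcost⟩ := exists_isFlow_of_source (hm.integrable (by norm_num)) N α
      have h1 := hdual _ hm m f hflow
      have e1 : ∀ z, φ z * (c * (Metric.closedBall x s).indicator 1 z)
          = c * (φ z * (Metric.closedBall x s).indicator 1 z) := fun z => by ring
      have e2 : ∀ z, |c * (Metric.closedBall x s).indicator 1 z|
          = 1 * (Metric.closedBall x s).indicator (1 : Rd d → ℝ) z := fun z => by
        rw [abs_mul, hc, abs_of_nonneg (indicator_nonneg (f := (1 : Rd d → ℝ))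
          (fun _ _ => zero_le_one) _)]
      simp only [e1, integral_const_mul] at h1
      rw [hcost] at h1
      simp only [e2] at h1
      rwa [setIntegral_mul_indicator_one (fun _ => 1) (hmeas x s) hs.2, setIntegral_const,
        smul_eq_mul, mul_one, hvol] at h1
    rw [havg x s hs.2, abs_div, abs_of_pos (hpos s hs.1), div_le_iff₀ (hpos s hs.1), abs_le']
    refine ⟨by simpa using hsource 1 (by simp), by simpa using hsource (-1) (by simp)⟩
  have hGne : G.Nonempty := by
    have hne : NeBot (ae (volume.restrict Ω)) := by
      rw [ae_neBot, Ne, Measure.restrict_eq_zero]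
      exact (Measure.measure_pos_of_nonempty_interior volume hΩi).ne'
    exact hGae.exists
  obtain ⟨Φ, hΦ, hΦb, hΦG⟩ := exists_nLip_extension N hGne hlip hbdd
  exact ⟨Φ, hΦ, hΦb, hGae.mono fun x hx => hΦG hx⟩

/-- Strong duality for stationary flows. -/
theorem exists_isFlow_flowCost_lt (hΩc : IsCompact Ω) (hΩ : Convex ℝ Ω)
    (hΩi : (interior Ω).Nonempty) (N : Seminorm ℝ (Rd d)) {α : ℝ} (hα : 0 < α) {g : Rd d → ℝ}
    (hg : IntegrableOn g Ω) {S : ℝ}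
    (hS : ∀ Φ, IsPotential Ω N α Φ → ∫ x in Ω, Φ x * g x ≤ S) {ε : ℝ} (hε : 0 < ε) :
    ∃ m f, IsFlow Ω g m f ∧ flowCost Ω N α m f < S + ε := by
  have hΩm := hΩc.measure_ne_top (μ := volume)
  have hfin : IsFiniteMeasure (volume.restrict Ω) := ⟨by simpa using hΩm.lt_top⟩
  have hα' : 0 < 1 / α := by positivity
  have hS0 : 0 ≤ S := by
    have h0 : NLip N (fun _ : Rd d => (0 : ℝ)) := fun x y => by simp
    simpa using hS _ (h0.isPotential (fun x => by simpa using hα'.le) Ω)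
  -- Separation takes place in `L²` while `g` is only integrable. With this tolerance, a source
  -- producing `g - h` costs at most `ε / 4`.
  obtain ⟨h, hhc, hgh, hhcont, hhi⟩ := Integrable.exists_hasCompactSupport_integral_sub_le hg
    (ε := α * (ε / 4)) (by positivity)
  have hgh' : 1 / α * ∫ x in Ω, |g x - h x| ≤ ε / 4 := by
    have := mul_le_mul_of_nonneg_left hgh hα'.le
    rwa [← mul_assoc, one_div_mul_cancel hα.ne', one_mul] at this
  have hk : IntegrableOn (fun x => g x - h x) Ω := hg.sub hhi
  have hh2 : MemLp h 2 (volume.restrict Ω) := hhcont.memLp_of_hasCompactSupport hhc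
  obtain ⟨m, f, hmf, hcost⟩ : ∃ m f, IsFlow Ω h m f ∧ flowCost Ω N α m f < S + ε / 2 := by
    -- Otherwise separation yields a potential with `∫ Φ h = S + ε / 2`, hence `∫ Φ g ≥ S + ε / 4`,
    -- against `hS`.
    by_contra! hcon
    obtain ⟨φ, hφ, hφh, hdual⟩ := exists_dual_function hΩc N hα (by linarith) hh2 hcon
    obtain ⟨Φ, hΦ, hΦb, hΦφ⟩ := exists_nLip_of_dual_function hΩc hΩ hΩi N hφ hdual
    have h1 : ∫ x in Ω, Φ x * h x = S + ε / 2 := by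
      rw [← hφh]
      exact integral_congr_ae (hΦφ.mono fun x hx => by simp only [hx])
    have h2 := hS Φ (hΦ.isPotential hΦb Ω)
    have hi : ∀ {k : Rd d → ℝ}, IntegrableOn k Ω → IntegrableOn (fun x => Φ x * k x) Ω :=
      fun hk => IntegrableOn.continuousOn_mul hΦ.continuous.continuousOn hk hΩc
    have h3 : ∫ x in Ω, Φ x * g x = (∫ x in Ω, Φ x * h x) + ∫ x in Ω, Φ x * (g x - h x) := by
      rw [← integral_add (hi hhi) (hi hk)]
      congr 1 with x
      ring
    have h4 : |∫ x in Ω, Φ x * (g x - h x)| ≤ 1 / α * ∫ x in Ω, |g x - h x| := by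
      rw [← integral_const_mul]
      refine norm_integral_le_of_norm_le (f := fun x => Φ x * (g x - h x)) (hk.abs.const_mul _)
        (Eventually.of_forall fun x => ?_)
      rw [norm_mul]
      exact mul_le_mul_of_nonneg_right (hΦb x) (abs_nonneg _)
    have h5 := (abs_le.1 h4).1
    linarith
  obtain ⟨m', f', hmf', hcost'⟩ := exists_isFlow_of_source hk N α
  refine ⟨_, _, (hmf.add hΩc hhi hk hmf').congr
    (Eventually.of_forall fun x => add_sub_cancel _ _), ?_⟩
  have := flowCost_add_le N hα hmf.integrable_momentum hmf'.integrable_momentum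
    hmf.integrable_source hmf'.integrable_source
  linarith

end StrongDuality

end UnnormalizedOT

/-! ### The duality formula -/

open UnnormalizedOT

theorem mainTheorem2 (d : ℕ) (Ω : Set (UnnormalizedOT.Rd d))
    (hΩ_compact : IsCompact Ω) (hΩ_convex : Convex ℝ Ω) (hΩ_int : (interior Ω).Nonempty)
    (N : Seminorm ℝ (UnnormalizedOT.Rd d)) (hN : ∀ u, N u = 0 → u = 0)
    (α : ℝ) (hα : 0 < α)
    (μ₀ μ₁ : UnnormalizedOT.Rd d → ℝ)
    (hμ₀ : UnnormalizedOT.IsDensity Ω μ₀) (hμ₁ : UnnormalizedOT.IsDensity Ω μ₁) :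
    UnnormalizedOT.UW1 Ω N α μ₀ μ₁ ≠ ⊤ ∧
      IsLUB {r : ℝ | ∃ Φ : UnnormalizedOT.Rd d → ℝ, UnnormalizedOT.IsPotential Ω N α Φ ∧
          r = ∫ x in Ω, Φ x * (μ₁ x - μ₀ x)}
        (UnnormalizedOT.UW1 Ω N α μ₀ μ₁).toReal := by
  have hg : IntegrableOn (fun x => μ₁ x - μ₀ x) Ω := hμ₁.integrable.sub hμ₀.integrable
  have hlower : ∀ Φ, IsPotential Ω N α Φ →
      ENNReal.ofReal (∫ x in Ω, Φ x * (μ₁ x - μ₀ x)) ≤ UW1 Ω N α μ₀ μ₁ := fun Φ hΦ =>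
    le_iInf fun ρ => le_iInf fun v => le_iInf fun f => le_iInf fun hadm =>
      hΦ.ofReal_integral_le_cost hΩ_compact hΩ_convex hΩ_int hμ₀ hμ₁ hN hadm
  have hupper : ∀ S, (∀ Φ, IsPotential Ω N α Φ → ∫ x in Ω, Φ x * (μ₁ x - μ₀ x) ≤ S) →
      ∀ ε, 0 < ε → UW1 Ω N α μ₀ μ₁ ≤ ENNReal.ofReal (S + ε) := fun S hS ε hε => by
    obtain ⟨m, f, hflow, hcost⟩ := exists_isFlow_flowCost_lt hΩ_compact hΩ_convex hΩ_int N hα hg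
      hS (half_pos hε)
    -- This `δ` keeps the extra source cost `δ |Ω| / α` below `ε / 2`, even when added to `1` in the
    -- denominator to avoid dividing by zero.
    obtain ⟨ρ, v, f', hadm, hle⟩ := hflow.exists_admissible hΩ_compact hμ₀ hμ₁ N hα
      (δ := ε / 2 * α / (volume.real Ω + 1)) (by positivity)
    have hinf : UW1 Ω N α μ₀ μ₁ ≤ cost Ω N α ρ v f' :=
      iInf_le_of_le ρ (iInf_le_of_le v (iInf_le_of_le f' (iInf_le _ hadm)))
    refine hinf.trans (hle.trans (ENNReal.ofReal_le_ofReal ?_))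
    have h1 : 1 / α * (ε / 2 * α / (volume.real Ω + 1) * volume.real Ω) ≤ ε / 2 := by
      have e : 1 / α * (ε / 2 * α / (volume.real Ω + 1) * volume.real Ω)
          = ε / 2 * (volume.real Ω / (volume.real Ω + 1)) := by field_simp
      rw [e]
      refine mul_le_of_le_one_right (by positivity) ((div_le_one (by positivity)).2 (by linarith))
    linarith
  -- The dual values are bounded, so `hupper` already gives finiteness.
  have hbound : ∀ Φ, IsPotential Ω N α Φ →
      ∫ x in Ω, Φ x * (μ₁ x - μ₀ x) ≤ 1 / α * ∫ x in Ω, |μ₁ x - μ₀ x| := fun Φ hΦ => by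
    rw [← integral_const_mul]
    refine (le_abs_self _).trans (norm_integral_le_of_norm_le
      (f := fun x => Φ x * (μ₁ x - μ₀ x)) (hg.abs.const_mul (1 / α)) ?_)
    filter_upwards [ae_restrict_mem hΩ_compact.measurableSet] with x hx
    rw [norm_mul]
    exact mul_le_mul_of_nonneg_right (hΦ.abs_le x hx) (abs_nonneg _)
  have hfin : UW1 Ω N α μ₀ μ₁ ≠ ⊤ :=
    ne_top_of_le_ne_top ENNReal.ofReal_ne_top (hupper _ hbound 1 one_pos)
  refine ⟨hfin, ?_, fun S hS => le_of_forall_pos_le_add fun ε hε => ?_⟩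
  · rintro _ ⟨Φ, hΦ, rfl⟩
    exact (ENNReal.ofReal_le_iff_le_toReal hfin).1 (hlower Φ hΦ)
  · have hS' : ∀ Φ, IsPotential Ω N α Φ → ∫ x in Ω, Φ x * (μ₁ x - μ₀ x) ≤ S :=
      fun Φ hΦ => hS ⟨Φ, hΦ, rfl⟩
    -- The zero potential is admissible; a nonnegative `S` lets the bound by `ENNReal.ofReal` pass
    -- to real numbers.
    have hS0 : 0 ≤ S := by
      have h0 : NLip N (fun _ : Rd d => (0 : ℝ)) := fun x y => by simp
      simpa using hS' _ (h0.isPotential (fun x => by simpa using hα.le) Ω)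
    exact ENNReal.toReal_le_of_le_ofReal (by positivity) (hupper S hS' ε hε)
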